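/- Let $r\ge 2$ and let $K$ be a number field of degree $d$ that is not a CM field (that is, not a totally complex quadratic extension of a totally real field), with $r_1$ real and $r_2$ pairs of complex embeddings, where $r_1+r_2=r+1$. Let $\sigma=(\sigma_1,\dots,\sigma_{r_1+r_2}):K\to\mathbb R^{r_1}\oplus\mathbb C^{r_2}$ be the canonical embedding, and let $\theta\in K$ act on $\mathbb R^{r_1}\oplus\mathbb C^{r_2}$ by $(\theta.\tilde x)_i=\sigma_i(\theta)\tilde x_i$. Let $\zeta:\mathbb Z^r\to\mathcal O_K^\times$, $n\mapsto\zeta^n$, be an injective homomorphism whose image has finite index, and let $\Gamma\le\sigma(K)$ be a cocompact lattice in $\mathbb R^{r_1}\oplus\mathbb C^{r_2}$, commensurable with $\sigma(\mathcal O_K)$, such that $\zeta^n.\Gamma\subset\Gamma$ for all $n\in\mathbb Z^r$. (This is the number-theoretic model of a faithful $\mathbb Z^r$-Cartan action on $\mathbb T^d$ that contains a totally irreducible automorphism.) Put $X=(\mathbb R^{r_1}\oplus\mathbb C^{r_2})/\Gamma$, and give $X^2$ the distance $(\mathbf x,\mathbf x')\mapsto\|\mathbf x-\mathbf x'\|$,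 where $\|\mathbf x\|$ is the least Euclidean norm of a lift of $\mathbf x$ to $(\mathbb R^{r_1}\oplus\mathbb C^{r_2})^2$. Let $\mathbb Z^r$ act on $X^2$ by $\zeta_\triangle^n.(x^{(1)},x^{(2)})=(\zeta^n.x^{(1)},\zeta^n.x^{(2)})$. Let $\langle\xi,\tilde x\rangle=\sum_{i\le r_1}\xi_i\tilde x_i+\sum_{r_1<i\le r_1+r_2}2\,\mathrm{Re}(\xi_i\tilde x_i)$, and identify the dual group of $X$ with $\hat X=\{\xi\in\mathbb R^{r_1}\oplus\mathbb C^{r_2}:\langle\xi,\gamma\rangle\in\mathbb Z\ \text{for all }\gamma\in\Gamma\}$. For $\kappa\in K$ let $T^\kappa$ be the set of $(x^{(1)},x^{(2)})\in X^2$ such that $\langle\xi^{(1)},x^{(1)}\rangle+\langle\xi^{(2)},x^{(2)}\rangle=0$ in $\mathbb R/\mathbb Z$ for all $\xi^{(1)},\xi^{(2)}\in\hat X$ with $\xi^{(1)}+\kappa.\xi^{(2)}=0$; define $T^\infty$ in the same way with the condition $\xi^{(2)}=0$ in place of $\xi^{(1)}+\kappa.\xi^{(2)}=0$. A *$d$-dimensional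 homogeneous $\zeta_\triangle$-invariant subset* of $X^2$ is a set of the form $$L=\{\zeta_\triangle^n.\mathbf z' : n\in\mathbb Z^r,\ \mathbf z'\in\mathbf z+T^\kappa\},$$ where $\mathbf z$ is a torsion point of $X^2$ and $\kappa\in K\cup\{\infty\}$. A subset of $X^2$ is *$\epsilon$-dense* if it intersects every open ball of radius $\epsilon$ in $X^2$. Then for every $\epsilon>0$ there are only finitely many $d$-dimensional homogeneous $\zeta_\triangle$-invariant subsets of $X^2$ that are not $\epsilon$-dense. -/

import Mathlib

open NumberField NumberField.mixedEmbedding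

noncomputable section

namespace DiagonalUnitAction

/-- The data `(K, ζ, Γ)`: the number-theoretic model of a `ℤ^r`-Cartan action with a totally
irreducible element.  Here `mixedSpace K` is `ℝ^{r₁} ⊕ ℂ^{r₂}`, `mixedEmbedding K` is the canonical
embedding `σ : K → ℝ^{r₁} ⊕ ℂ^{r₂}`, and the action of `θ ∈ K` on `ℝ^{r₁} ⊕ ℂ^{r₂}` is coordinatewise
multiplication by `σ θ`. -/
structure Model (K : Type*) [Field K] [NumberField K] (r : ℕ) where
  /-- `K` is not a CM field. -/
  not_isCM : ¬ IsCMField K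
  /-- `r₁ + r₂ = r + 1`. -/
  places : InfinitePlace.nrRealPlaces K + InfinitePlace.nrComplexPlaces K = r + 1
  /-- The homomorphism `n ↦ ζ^n` from `ℤ^r` to the group of units. -/
  ζ : Multiplicative (Fin r → ℤ) →* (𝓞 K)ˣ
  ζ_injective : Function.Injective ζ
  ζ_finiteIndex : ζ.range.FiniteIndex
  /-- The lattice `Γ`. -/
  Γ : AddSubgroup (mixedSpace K)
  Γ_le : Γ ≤ (mixedEmbedding K).toAddMonoidHom.range
  Γ_discrete : DiscreteTopology Γ
  Γ_cocompact : CompactSpace (mixedSpace K ⧸ Γ)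
  Γ_commensurable : AddSubgroup.Commensurable Γ
    ((mixedEmbedding K).comp (algebraMap (𝓞 K) K)).toAddMonoidHom.range
  Γ_stable : ∀ n : Multiplicative (Fin r → ℤ), ∀ γ ∈ Γ, mixedEmbedding K (ζ n : K) * γ ∈ Γ

open scoped Classical in
/-- The bilinear form `∑_{i ≤ r₁} ξ_i x_i + ∑_{i > r₁} 2 Re (ξ_i x_i)`, as an additive map in `x`. -/
def pairing {K : Type*} [Field K] [NumberField K] (ξ : mixedSpace K) : mixedSpace K →+ ℝ where
  toFun x := ∑ w, ξ.1 w * x.1 w + ∑ w, 2 * (ξ.2 w * x.2 w).re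
  map_zero' := by simp
  map_add' x y := by
    simp only [Prod.fst_add, Prod.snd_add, Pi.add_apply, mul_add, Complex.add_re,
      Finset.sum_add_distrib]
    ring

open scoped Classical in
/-- The Euclidean norm on `(ℝ^{r₁} ⊕ ℂ^{r₂})²`. -/
def euclNorm {K : Type*} [Field K] [NumberField K] (v : mixedSpace K × mixedSpace K) : ℝ :=
  √(∑ w, ‖v.1.1 w‖ ^ 2 + ∑ w, ‖v.1.2 w‖ ^ 2 + ∑ w, ‖v.2.1 w‖ ^ 2 + ∑ w, ‖v.2.2 w‖ ^ 2)

namespace Model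

variable {K : Type*} [Field K] [NumberField K] {r : ℕ} (M : Model K r)

/-- The compact group `X = (ℝ^{r₁} ⊕ ℂ^{r₂}) / Γ`. -/
abbrev X : Type _ := mixedSpace K ⧸ M.Γ

/-- The quotient map `π_△ : (ℝ^{r₁} ⊕ ℂ^{r₂})² → X²`. -/
def proj : mixedSpace K × mixedSpace K →+ M.X × M.X :=
  (QuotientAddGroup.mk' M.Γ).prodMap (QuotientAddGroup.mk' M.Γ)

/-- `‖x‖`, the least Euclidean norm of a lift of `x ∈ X²`. -/
def norm (x : M.X × M.X) : ℝ := sInf (euclNorm '' {v | M.proj v = x})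

/-- The action of `ℤ^r` on `X`, induced by multiplication by `ζ^n`. -/
def act (n : Multiplicative (Fin r → ℤ)) : M.X →+ M.X :=
  QuotientAddGroup.map M.Γ M.Γ (AddMonoidHom.mulLeft (mixedEmbedding K (M.ζ n : K)))
    (fun γ hγ => M.Γ_stable n γ hγ)

/-- The diagonal action of `ℤ^r` on `X²`. -/
def diagAct (n : Multiplicative (Fin r → ℤ)) (x : M.X × M.X) : M.X × M.X :=
  (M.act n x.1, M.act n x.2)

/-- The dual group of `X`, as the subgroup `{ξ : ⟨ξ, γ⟩ ∈ ℤ for all γ ∈ Γ}` of `ℝ^{r₁} ⊕ ℂ^{r₂}`. -/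
def dual : Set (mixedSpace K) := {ξ | ∀ γ ∈ M.Γ, ∃ m : ℤ, pairing ξ γ = m}

/-- The character `⟨ξ, ·⟩ : X → ℝ / ℤ` attached to an element `ξ` of the dual group. -/
def character (ξ : M.dual) : M.X →+ UnitAddCircle :=
  QuotientAddGroup.lift M.Γ
    ((QuotientAddGroup.mk' (AddSubgroup.zmultiples (1 : ℝ))).comp (pairing ξ.1))
    (fun γ hγ => by
      obtain ⟨m, hm⟩ := ξ.2 γ hγ
      refine (QuotientAddGroup.eq_zero_iff _).2 (AddSubgroup.mem_zmultiples_iff.2 ⟨m, ?_⟩)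
      simp [hm])

/-- For `κ ∈ K` the set of `(ξ₁, ξ₂)` in the dual group of `X²` with `ξ₁ + κ ξ₂ = 0`;
for `κ = ∞` the set of those with `ξ₂ = 0`. -/
def dualSlope : OnePoint K → Set (M.dual × M.dual)
  | OnePoint.some κ => {ξ | ξ.1.1 + mixedEmbedding K κ * ξ.2.1 = 0}
  | OnePoint.infty => {ξ | ξ.2.1 = 0}

/-- The `d`-dimensional homogeneous invariant subtorus `T^κ`, the annihilator in `X²` of
`dualSlope κ`. -/
def torus (κ : OnePoint K) : AddSubgroup (M.X × M.X) where
  carrier := {x | ∀ ξ ∈ M.dualSlope κ, M.character ξ.1 x.1 + M.character ξ.2 x.2 = 0}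
  zero_mem' ξ _ := by simp
  add_mem' {x y} hx hy ξ hξ := by
    have h := congrArg₂ (· + ·) (hx ξ hξ) (hy ξ hξ)
    simp only [add_zero] at h
    rw [Prod.fst_add, Prod.snd_add, map_add, map_add, add_add_add_comm, h]
  neg_mem' {x} hx ξ hξ := by
    rw [Prod.fst_neg, Prod.snd_neg, map_neg, map_neg, ← neg_add, hx ξ hξ, neg_zero]

/-- `L` is a `d`-dimensional homogeneous invariant subset of `X²`: the union of the images of
`z + T^κ` under the diagonal action, for some torsion point `z` and some `κ ∈ K ∪ {∞}`. -/
def IsHomogeneous (L : Set (M.X × M.X)) : Prop :=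
  ∃ z : M.X × M.X, IsOfFinAddOrder z ∧ ∃ κ : OnePoint K,
    L = {x | ∃ n : Multiplicative (Fin r → ℤ), ∃ t ∈ M.torus κ, x = M.diagAct n (z + t)}

/-- `A` intersects every open ball of radius `ε` of `X²`. -/
def IsEpsDense (ε : ℝ) (A : Set (M.X × M.X)) : Prop :=
  ∀ y : M.X × M.X, ∃ x ∈ A, M.norm (x - y) < ε

end Model

end DiagonalUnitAction

end

/-! A homogeneous set of slope κ is the preimage of a single orbit under X² → X²/T^κ
(`homogeneous_eq_preimage_orbit`). Finiteness therefore splits into two questions: which slopes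
occur, and, for a given slope, which orbits occur in the quotient.

Slopes (`finite_slopes`). Comparing means of a trigonometric polynomial close to a bump function
shows that every translate of a closed subgroup meets a given neighbourhood of 0, unless one of
finitely many nontrivial characters, depending only on the neighbourhood, vanishes on the subgroup
(`exists_finset_forall_closed_addSubgroup`). A nontrivial character of X² vanishes on at most one
T^κ, so all but finitely many T^κ have only ε-dense translates.

Orbits (`finite_homogeneous_of_slope`). X²/T^κ is a compact quotient of ℝ^{r₁} ⊕ ℂ^{r₂} on which the
units act, and there an infinite closed invariant set is everything (`eq_univ_of_infinite`). So the
orbits avoiding a nonempty open set have a union with finite closure, and there are finitely many of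
them.

The rigidity statement is in the style of Furstenberg and Berend. If the set accumulates at 0, units
that are large at one place only produce a nonzero point of the set on a coordinate axis
(`exists_incl_mem`). Units h large at that place and g near 1 move this point in small, nearly equal
steps, which in the limit fill a ray (`exists_ray_subset`). Since r ≥ 2 there are three places,
hence units near 1 at any one of them; since K is not CM, the arguments of units at a complex place
are dense. So the ray can be chosen orthogonal to no nonzero frequency, and it is dense.
Accumulation elsewhere is reduced to accumulation at 0 by difference sets and the density of
periodic points (`eq_univ_of_infinite_of_invariant`). -/

namespace DiagonalUnitAction

open MeasureTheory Topology Filter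

/-! ### Characters of compact groups and translates of closed subgroups -/

section Characters

/-- Over an invariant measure, a nontrivial character of a group has integral zero. -/
theorem integral_toCircle_comp_eq_zero {G : Type*} [AddCommGroup G] [MeasurableSpace G]
    [MeasurableAdd G] (μ : Measure G) [μ.IsAddLeftInvariant] (χ : G →+ UnitAddCircle)
    (hχ : ∃ g, χ g ≠ 0) : ∫ g, (AddCircle.toCircle (χ g) : ℂ) ∂μ = 0 := by
  obtain ⟨g, hg⟩ := hχ
  have h := integral_add_left_eq_self (μ := μ) (fun x => (AddCircle.toCircle (χ x) : ℂ)) g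
  simp only [map_add, AddCircle.toCircle_add, Circle.coe_mul, integral_const_mul] at h
  by_contra hne
  refine hg (AddCircle.injective_toCircle (T := (1 : ℝ)) one_ne_zero ?_)
  rw [AddCircle.toCircle_zero]
  exact Circle.ext (by simpa using mul_right_cancel₀ hne (h.trans (one_mul _).symm))

variable {Y : Type*} [AddCommGroup Y] [TopologicalSpace Y]

/-- The continuous function `Y → ℂ` attached to a continuous character. -/
noncomputable def charFun (χ : Y →+ UnitAddCircle) (hχ : Continuous χ) : C(Y, ℂ) where
  toFun y := AddCircle.toCircle (χ y)
  continuous_toFun := continuous_subtype_val.comp (AddCircle.continuous_toCircle.comp hχ)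

theorem charFun_apply (χ : Y →+ UnitAddCircle) (hχ : Continuous χ) (y : Y) :
    charFun χ hχ y = AddCircle.toCircle (χ y) := rfl

variable {G : Type*} [AddCommGroup G]

/-- Stone-Weierstrass for a separating group of characters. -/
theorem span_charFun_dense [CompactSpace Y] (e : G →+ Y →+ UnitAddCircle)
    (he : ∀ g, Continuous (e g)) (hsep : ∀ y, y ≠ 0 → ∃ g, e g y ≠ 0) :
    (Submodule.span ℂ (Set.range fun g => charFun (e g) (he g))).topologicalClosure = ⊤ := by
  let A : StarSubalgebra ℂ C(Y, ℂ) :=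
    { toSubalgebra := Algebra.adjoin ℂ (Set.range fun g => charFun (e g) (he g))
      star_mem' := by
        change Algebra.adjoin ℂ (Set.range fun g => charFun (e g) (he g)) ≤
          star (Algebra.adjoin ℂ (Set.range fun g => charFun (e g) (he g)))
        refine Algebra.adjoin_le ?_
        rintro - ⟨g, rfl⟩
        refine Algebra.subset_adjoin ⟨-g, ?_⟩
        ext y
        simp [charFun_apply, AddCircle.toCircle_neg, ← Circle.coe_inv_eq_conj] }
  have hA : Subalgebra.toSubmodule A.toSubalgebra =
      Submodule.span ℂ (Set.range fun g => charFun (e g) (he g)) := by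
    apply Algebra.adjoin_eq_span_of_subset
    refine Set.Subset.trans ?_ Submodule.subset_span
    intro x hx
    refine Submonoid.closure_induction (fun _ => id) ⟨0, ?_⟩ ?_ hx
    · ext y; simp [charFun_apply]
    · rintro - - - - ⟨m, rfl⟩ ⟨n, rfl⟩
      refine ⟨m + n, ?_⟩
      ext y
      simp [charFun_apply, AddCircle.toCircle_add]
  have hs : A.SeparatesPoints := by
    intro x y hxy
    obtain ⟨g, hg⟩ := hsep (x - y) (sub_ne_zero.2 hxy)
    refine ⟨_, ⟨charFun (e g) (he g), Algebra.subset_adjoin ⟨g, rfl⟩, rfl⟩, fun h => hg ?_⟩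
    rw [map_sub, sub_eq_zero]
    exact AddCircle.injective_toCircle (T := (1 : ℝ)) one_ne_zero (Circle.ext h)
  have := ContinuousMap.starSubalgebra_topologicalClosure_eq_top_of_separatesPoints A hs
  rw [← hA]
  exact congrArg (fun B : StarSubalgebra ℂ C(Y, ℂ) => Subalgebra.toSubmodule B.toSubalgebra) this

open scoped Classical in
/-- If a trigonometric polynomial approximates `f` up to `δ`, then its constant term approximates
the mean of `f` up to `δ` along every map into the group on which no nontrivial character that
occurs becomes trivial. -/
theorem norm_integral_sub_constTerm_le [CompactSpace Y] [IsTopologicalAddGroup Y]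
    (e : G →+ Y →+ UnitAddCircle) (he : ∀ g, Continuous (e g)) (c : G →₀ ℂ) (f : C(Y, ℝ)) {δ : ℝ}
    (hf : ∀ y, ‖(f y : ℂ) - ∑ g ∈ c.support, c g * (AddCircle.toCircle (e g y) : ℂ)‖ ≤ δ)
    {Z : Type*} [AddCommGroup Z] [TopologicalSpace Z] [CompactSpace Z] [IsTopologicalAddGroup Z]
    [MeasurableSpace Z] [BorelSpace Z] (ν : Measure Z) [ν.IsAddLeftInvariant]
    [IsProbabilityMeasure ν] (j : Z →+ Y) (hj : Continuous j) (y : Y)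
    (hne : ∀ g ∈ c.support, e g ≠ 0 → ∃ z, e g (j z) ≠ 0) :
    ‖((∫ z, f (y + j z) ∂ν : ℝ) : ℂ) - ∑ g ∈ c.support with e g = 0, c g‖ ≤ δ := by
  have hint : ∀ {k : Z → ℂ}, Continuous k → Integrable k ν := fun hk =>
    hk.integrable_of_hasCompactSupport (HasCompactSupport.of_compactSpace _)
  have hcont : ∀ g, Continuous fun z => c g * (AddCircle.toCircle (e g (y + j z)) : ℂ) :=
    fun g => continuous_const.mul (continuous_subtype_val.comp
      (AddCircle.continuous_toCircle.comp ((he g).comp (by fun_prop))))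
  have hmean : ∫ z, ∑ g ∈ c.support, c g * (AddCircle.toCircle (e g (y + j z)) : ℂ) ∂ν =
      ∑ g ∈ c.support with e g = 0, c g := by
    rw [integral_finsetSum _ fun g _ => hint (hcont g), Finset.sum_filter]
    refine Finset.sum_congr rfl fun g hg => ?_
    split_ifs with h0
    · simp [h0]
    · simp only [map_add, AddCircle.toCircle_add, Circle.coe_mul, integral_const_mul]
      have := integral_toCircle_comp_eq_zero ν ((e g).comp j) (hne g hg h0)
      simp only [AddMonoidHom.coe_comp, Function.comp_apply] at this
      rw [this, mul_zero, mul_zero]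
  have hfi : Continuous fun z => ((f (y + j z) : ℝ) : ℂ) := by fun_prop
  rw [← hmean, ← integral_complex_ofReal, ← integral_sub (hint hfi)
    (hint (continuous_finsetSum _ fun g _ => hcont g))]
  refine (norm_integral_le_of_norm_le_const (C := δ) (ae_of_all _ fun z => hf _)).trans ?_
  simp

variable [IsTopologicalAddGroup Y] [CompactSpace Y] [T2Space Y]

/-- If none of finitely many characters is trivial on a closed subgroup, then each translate of
the subgroup meets a given neighbourhood of `0`. -/
theorem exists_finset_forall_closed_addSubgroup (e : G →+ Y →+ UnitAddCircle)
    (he : ∀ g, Continuous (e g)) (hsep : ∀ y, y ≠ 0 → ∃ g, e g y ≠ 0) {U : Set Y}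
    (hU : U ∈ 𝓝 (0 : Y)) :
    ∃ F : Finset G, (∀ g ∈ F, e g ≠ 0) ∧ ∀ H : AddSubgroup Y, IsClosed (H : Set Y) →
      (∀ g ∈ F, ∃ h ∈ H, e g h ≠ 0) → ∀ y, ∃ h ∈ H, y + h ∈ U := by
  classical
  let _ : MeasurableSpace Y := borel Y
  have : BorelSpace Y := ⟨rfl⟩
  obtain ⟨f, hf0, hf1, hf⟩ := exists_continuous_zero_one_of_isClosed
    (isOpen_interior (s := U)).isClosed_compl (isClosed_singleton (x := (0 : Y)))
    (Set.disjoint_singleton_right.2 (by simpa using mem_interior_iff_mem_nhds.2 hU))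
  let μ : Measure Y := Measure.addHaarMeasure ⊤
  have : IsFiniteMeasure μ := CompactSpace.isFiniteMeasure
  have hμ1 : μ Set.univ = 1 := Measure.addHaarMeasure_self (K₀ := ⊤)
  have : IsProbabilityMeasure μ := ⟨hμ1⟩
  have hIpos : 0 < ∫ y, f y ∂μ := by
    refine f.continuous.integral_pos_of_hasCompactSupport_nonneg_nonzero
      (HasCompactSupport.of_compactSpace _) (fun y => (hf y).1) (x := 0) ?_
    simp [hf1 (Set.mem_singleton _)]
  set I := ∫ y, f y ∂μ with hI
  let fC : C(Y, ℂ) := ⟨fun y => (f y : ℂ), by fun_prop⟩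
  have hcl : fC ∈ closure ((Submodule.span ℂ (Set.range fun g => charFun (e g) (he g)) :
      Submodule ℂ C(Y, ℂ)) : Set C(Y, ℂ)) := by
    rw [← Submodule.topologicalClosure_coe, span_charFun_dense e he hsep]
    trivial
  -- The constant term of the polynomial will be within I/3 of the mean I of f over Y, and within
  -- I/3 of the mean over y + H. The latter is 0 if y + H misses U, and 2I/3 < I.
  obtain ⟨P, hP, hPf⟩ := Metric.mem_closure_iff.1 hcl (I / 3) (by positivity)
  obtain ⟨c, rfl⟩ := Finsupp.mem_span_range_iff_exists_finsupp.1 hP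
  have hPeval : ∀ y, (c.sum fun i a => a • charFun (e i) (he i)) y =
      ∑ g ∈ c.support, c g * (AddCircle.toCircle (e g y) : ℂ) := by
    intro y
    simp [Finsupp.sum, charFun_apply]
  have hPdist : ∀ y, ‖(f y : ℂ) - ∑ g ∈ c.support, c g * (AddCircle.toCircle (e g y) : ℂ)‖ ≤
      I / 3 := by
    intro y
    rw [← hPeval, ← dist_eq_norm]
    exact (ContinuousMap.dist_apply_le_dist y).trans hPf.le
  -- Since `e` need not be injective, several indices can contribute to the constant term.
  set c₀ : ℂ := ∑ g ∈ c.support with e g = 0, c g with hc₀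
  refine ⟨c.support.filter fun g => e g ≠ 0, fun g hg => (Finset.mem_filter.1 hg).2,
    fun H hH hF y => ?_⟩
  have : CompactSpace H := isCompact_iff_compactSpace.1 hH.isCompact
  have h1 : ‖(I : ℂ) - c₀‖ ≤ I / 3 := by
    have := norm_integral_sub_constTerm_le e he c f hPdist μ (AddMonoidHom.id Y) continuous_id 0
      (fun g _ h0 => by
        by_contra! h
        exact h0 (AddMonoidHom.ext h))
    simpa using this
  let ν : Measure H := Measure.addHaarMeasure ⊤
  have hν : ν Set.univ = 1 := Measure.addHaarMeasure_self (K₀ := ⊤)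
  have : IsProbabilityMeasure ν := ⟨hν⟩
  have h2 := norm_integral_sub_constTerm_le e he c f hPdist ν H.subtype continuous_subtype_val y
    (fun g hg h0 => by
      obtain ⟨h, hh, hne⟩ := hF g (Finset.mem_filter.2 ⟨hg, h0⟩)
      exact ⟨⟨h, hh⟩, hne⟩)
  by_contra! hcon
  have hz : ∀ h : H, f (y + h) = 0 := fun h =>
    hf0 fun hmem => hcon h h.2 (interior_subset hmem)
  simp only [AddSubgroup.coe_subtype, hz, integral_zero, Complex.ofReal_zero] at h2
  have h3 : ‖(I : ℂ)‖ ≤ I / 3 + I / 3 := by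
    calc ‖(I : ℂ)‖ = ‖((I : ℂ) - c₀) - (0 - c₀)‖ := by ring_nf
      _ ≤ _ := (norm_sub_le _ _).trans (add_le_add h1 h2)
  rw [Complex.norm_real, Real.norm_eq_abs, abs_of_pos hIpos] at h3
  linarith

/-- No nontrivial character vanishes on the closure of H, so the previous lemma applies to that
closure for every neighbourhood; a point of the closure is then replaced by a nearby point of H. -/
theorem dense_of_forall_character (e : G →+ Y →+ UnitAddCircle) (he : ∀ g, Continuous (e g))
    (hsep : ∀ y, y ≠ 0 → ∃ g, e g y ≠ 0) (H : AddSubgroup Y)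
    (hH : ∀ g, (∀ h ∈ H, e g h = 0) → e g = 0) : Dense (H : Set Y) := by
  intro y
  rw [mem_closure_iff_nhds_zero]
  intro U hU
  obtain ⟨F, hF, hF'⟩ := exists_finset_forall_closed_addSubgroup e he hsep
    (inter_mem (interior_mem_nhds.2 hU) (interior_mem_nhds.2 (neg_mem_nhds_zero Y hU)))
  obtain ⟨h, hh, hyU⟩ := hF' H.topologicalClosure H.isClosed_topologicalClosure
    (fun g hg => by
      by_contra! hcon
      exact hF g hg (hH g fun h hh => hcon h (H.le_topologicalClosure hh))) (-y)
  obtain ⟨h', hh', hm⟩ := mem_closure_iff_nhds.1 hh _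
    ((isOpen_interior.preimage (by fun_prop : Continuous fun z : Y => -y + z)).mem_nhds hyU.1)
  exact ⟨h', hm, by simpa [sub_eq_neg_add] using interior_subset hh'⟩

end Characters

/-! ### Furstenberg's difference-set argument -/

section Action

/-- Points with a finite orbit under a subgroup of finite index have a stabilizer of finite
index. -/
theorem finiteIndex_stabilizer_of_finite {H Y : Type*} [Group H] [AddCommGroup Y]
    [DistribMulAction H Y] {S : Subgroup H} (hS : S.FiniteIndex) {Z : Set Y}
    (hZ : Z.Finite) (hinv : ∀ s ∈ S, ∀ z ∈ Z, s • z ∈ Z) {x : Y} (hx : x ∈ Z) :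
    (MulAction.stabilizer H x).FiniteIndex := by
  have hfin : (MulAction.orbit S x).Finite := hZ.subset (by
    rintro _ ⟨s, rfl⟩
    exact hinv s s.2 x hx)
  have : Finite (S ⧸ MulAction.stabilizer S x) :=
    Finite.of_equiv _ ((MulAction.orbitEquivQuotientStabilizer S x)) (h := hfin)
  have h1 : ((MulAction.stabilizer H x).subgroupOf S).index ≠ 0 :=
    (Subgroup.finiteIndex_of_finite_quotient (H := MulAction.stabilizer S x)).index_ne_zero
  refine ⟨fun h0 => ?_⟩
  have h2 : (MulAction.stabilizer H x ⊓ S).index = 0 :=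
    Nat.eq_zero_of_zero_dvd (h0 ▸ Subgroup.index_dvd_of_le inf_le_left)
  rw [← Subgroup.relIndex_mul_index inf_le_right, Subgroup.inf_relIndex_right] at h2
  exact (mul_ne_zero h1 hS.index_ne_zero) h2

variable {Y : Type*} [AddCommGroup Y] [TopologicalSpace Y] [IsTopologicalAddGroup Y]

/-- Used both for B = A - A and for B = A - x, which is why B only has to contain the differences
with x. -/
theorem AccPt.zero_of_add {x : Y} {A B : Set Y} (h : AccPt x (𝓟 A))
    (hB : ∀ b, b + x ∈ A → b ∈ B) : AccPt 0 (𝓟 B) := by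
  rw [accPt_iff_frequently] at h ⊢
  have ht : Tendsto (fun y => y - x) (𝓝 x) (𝓝 0) := by
    have h0 : Continuous fun y : Y => y - x := by fun_prop
    simpa using h0.tendsto x
  exact ht.frequently (h.mono fun y hy => ⟨sub_ne_zero.2 hy.1, hB _ (by simpa using hy.2)⟩)

variable {H : Type*} [Group H] [DistribMulAction H Y] [CompactSpace Y] [T2Space Y]

/-- An invariant closed set without periodic points contains a translate of every finite set of
periodic points, if invariant sets that accumulate at `0` are everything. -/
theorem exists_forall_add_mem_of_periodic
    (hacc : ∀ S : Subgroup H, S.FiniteIndex → ∀ A : Set Y, IsClosed A →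
      (∀ s ∈ S, ∀ a ∈ A, s • a ∈ A) → AccPt 0 (𝓟 A) → A = Set.univ)
    {X : Set Y} (hX : IsClosed X) (hinv : ∀ h : H, ∀ x ∈ X, h • x ∈ X) (hne : X.Nonempty)
    (hper : ∀ x ∈ X, ¬ (MulAction.stabilizer H x).FiniteIndex) (E : Finset Y)
    (hE : ∀ e ∈ E, (MulAction.stabilizer H e).FiniteIndex) :
    ∃ x ∈ X, ∀ e ∈ E, x + e ∈ X := by
  classical
  suffices h : ∃ S : Subgroup H, S.FiniteIndex ∧ ∃ Z ⊆ X, IsClosed Z ∧ Z.Nonempty ∧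
      (∀ s ∈ S, ∀ z ∈ Z, s • z ∈ Z) ∧ ∀ e ∈ E, ∀ z ∈ Z, z + e ∈ X by
    obtain ⟨-, -, Z, hZX, -, ⟨z, hz⟩, -, h⟩ := h
    exact ⟨z, hZX hz, fun e he => h e he z hz⟩
  induction E using Finset.induction_on with
  | empty => exact ⟨⊤, inferInstance, X, subset_rfl, hX, hne, fun s _ => hinv s, by simp⟩
  | insert e E _ ih =>
    obtain ⟨S, hS, Z, hZX, hZ, ⟨z₀, hz₀⟩, hZinv, hZE⟩ :=
      ih fun e' he' => hE e' (Finset.mem_insert_of_mem he')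
    have hSe := hE e (Finset.mem_insert_self _ _)
    have hZinf : Z.Infinite := fun hfin =>
      hper z₀ (hZX hz₀) (finiteIndex_stabilizer_of_finite hS hfin hZinv hz₀)
    obtain ⟨x, hx⟩ := hZinf.exists_accPt_principal
    have hxZ : x ∈ Z := hZ.closure_eq ▸ mem_closure_iff_clusterPt.2 hx.clusterPt
    -- Z - Z is closed, S-invariant and accumulates at 0, so it contains e = a - b. Hence Z ∩ (Z -
    -- e) contains b, and it is invariant under the elements of S that fix e.
    have hD : (fun p : Y × Y => p.1 - p.2) '' (Z ×ˢ Z) = Set.univ := by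
      refine hacc S hS _ ((hZ.isCompact.prod hZ.isCompact).image (by fun_prop)).isClosed ?_
        (AccPt.zero_of_add hx fun b hb => ⟨(b + x, x), ⟨hb, hxZ⟩, by simp⟩)
      rintro s hs _ ⟨⟨a, b⟩, ⟨ha, hb⟩, rfl⟩
      exact ⟨(s • a, s • b), ⟨hZinv s hs a ha, hZinv s hs b hb⟩, (smul_sub s a b).symm⟩
    obtain ⟨⟨a, b⟩, ⟨ha, hb⟩, hab⟩ := hD.ge (Set.mem_univ e)
    refine ⟨S ⊓ MulAction.stabilizer H e, inferInstance, Z ∩ (fun z => z + e) ⁻¹' Z,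
      Set.inter_subset_left.trans hZX, hZ.inter (hZ.preimage (by fun_prop)),
      ⟨b, hb, ?_⟩, ?_, ?_⟩
    · simpa [← hab] using ha
    · rintro s ⟨hs, hse⟩ z ⟨hz, hze⟩
      refine ⟨hZinv s hs z hz, ?_⟩
      have := hZinv s hs _ hze
      rwa [smul_add, MulAction.mem_stabilizer_iff.1 hse] at this
    · intro e' he' z hz
      rcases Finset.mem_insert.1 he' with rfl | he'
      · exact hZX hz.2
      · exact hZE e' he' z hz.1

/-- If periodic points are dense, and closed sets that are invariant under a subgroup of finite
index and accumulate at `0` are everything, then infinite closed invariant sets are everything. -/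
theorem eq_univ_of_infinite_of_invariant [ContinuousConstSMul H Y]
    (hacc : ∀ S : Subgroup H, S.FiniteIndex → ∀ A : Set Y, IsClosed A →
      (∀ s ∈ S, ∀ a ∈ A, s • a ∈ A) → AccPt 0 (𝓟 A) → A = Set.univ)
    (hdense : Dense {y : Y | (MulAction.stabilizer H y).FiniteIndex})
    {A : Set Y} (hA : IsClosed A) (hinv : ∀ h : H, ∀ a ∈ A, h • a ∈ A) (hinf : A.Infinite) :
    A = Set.univ := by
  have hXA : derivedSet A ⊆ A := (isClosed_iff_derivedSet_subset A).1 hA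
  by_cases hper : ∃ x ∈ derivedSet A, (MulAction.stabilizer H x).FiniteIndex
  · obtain ⟨x, hx, hS⟩ := hper
    -- Translating by the periodic accumulation point x keeps invariance under its stabilizer and
    -- moves the accumulation to 0.
    have := hacc _ hS ((fun y => y + x) ⁻¹' A) (hA.preimage (by fun_prop)) (fun s hs a ha => by
      have := hinv s _ ha
      rwa [smul_add, MulAction.mem_stabilizer_iff.1 hs] at this)
      (AccPt.zero_of_add hx fun _ hb => hb)
    refine Set.eq_univ_of_forall fun y => ?_
    simpa using this.ge (Set.mem_univ (y - x))
  push Not at hper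
  have hXinv : ∀ h : H, ∀ x ∈ derivedSet A, h • x ∈ derivedSet A := by
    intro h x hx
    rw [mem_derivedSet, accPt_iff_frequently] at hx ⊢
    exact ((continuous_const_smul h).tendsto x).frequently (hx.mono fun y hy =>
      ⟨fun he => hy.1 (smul_left_cancel h he), hinv h y hy.2⟩)
  obtain ⟨x₀, hx₀⟩ := hinf.exists_accPt_principal
  by_contra hcon
  obtain ⟨w, hw⟩ := (Set.ne_univ_iff_exists_notMem _).1 hcon
  replace hw : w ∉ derivedSet A := fun h => hw (hXA h)
  have hXcl : IsClosed (derivedSet A) := isClosed_derivedSet A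
  -- By density of periodic points, finitely many translates e + U with e periodic cover Y. The
  -- derived set contains some x + E; but w - x lies in one e + U, which says that x + e is not in
  -- the derived set.
  set U : Set Y := (fun u => w - u) ⁻¹' (derivedSet A)ᶜ
  have hU : IsOpen U := hXcl.isOpen_compl.preimage (by fun_prop)
  have hU0 : (0 : Y) ∈ U := by simpa [U] using hw
  obtain ⟨E, hE, hcov⟩ := isCompact_univ.elim_finite_subcover_image
    (b := {y : Y | (MulAction.stabilizer H y).FiniteIndex}) (c := fun e => (fun y => y - e) ⁻¹' U)
    (fun e _ => hU.preimage (by fun_prop)) (fun y _ => by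
      obtain ⟨e, he, hP⟩ := hdense.inter_open_nonempty ((fun e => y - e) ⁻¹' U)
        (hU.preimage (by fun_prop)) ⟨y, by simpa using hU0⟩
      exact Set.mem_biUnion hP he)
  obtain ⟨hEfin, hcov⟩ := hcov
  obtain ⟨x, -, hx⟩ := exists_forall_add_mem_of_periodic hacc hXcl hXinv ⟨x₀, hx₀⟩ hper
    hEfin.toFinset (fun e he => hE (hEfin.mem_toFinset.1 he))
  obtain ⟨e, he, hxe⟩ := Set.mem_iUnion₂.1 (hcov (Set.mem_univ (w - x)))
  exact hxe (by
    have := hx e (hEfin.mem_toFinset.2 he)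
    change w - (w - x - e) ∈ derivedSet A
    rwa [show w - (w - x - e) = x + e by abel])

end Action

/-! ### Units: large at one place, close to 1, and of dense argument -/

section Units

variable {K : Type*} [Field K]

theorem norm_embedding_unit_pos (w : InfinitePlace K) (u : (𝓞 K)ˣ) : 0 < ‖w.embedding (u : K)‖ := by
  rw [InfinitePlace.norm_embedding_eq]
  exact Units.pos_at_place u w

variable [NumberField K]

/-- A subgroup of finite index contains units that are large at a given place only. -/
theorem exists_unit_large_at_place [Nontrivial (InfinitePlace K)] {S : Subgroup (𝓞 K)ˣ}
    (hS : S.FiniteIndex) (w₁ : InfinitePlace K) :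
    ∃ u ∈ S, 1 < w₁ (u : K) ∧ ∀ w, w ≠ w₁ → w (u : K) < 1 := by
  classical
  obtain ⟨u, hu⟩ := Units.dirichletUnitTheorem.exists_unit K w₁
  have hlt : ∀ w, w ≠ w₁ → w (u : K) < 1 := fun w hw => by
    have := hu w hw
    rwa [Real.log_neg_iff (Units.pos_at_place u w)] at this
  -- The product formula: the weighted logarithms sum to 0, and all the others are negative.
  have hgt : 1 < w₁ (u : K) := by
    have hsum := Units.sum_mult_mul_log u
    rw [Fintype.sum_eq_add_sum_subtype_ne _ w₁] at hsum
    obtain ⟨w₂, hw₂⟩ := exists_ne w₁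
    have hneg : ∑ w : {w // w ≠ w₁}, (w.1.mult : ℝ) * Real.log (w.1 (u : K)) < 0 :=
      Finset.sum_neg (fun w _ => mul_neg_of_pos_of_neg (by exact_mod_cast w.1.mult_pos)
        (hu w w.2)) ⟨⟨w₂, hw₂⟩, Finset.mem_univ _⟩
    have : 0 < (w₁.mult : ℝ) * Real.log (w₁ (u : K)) := by linarith
    rwa [mul_pos_iff_of_pos_left (by exact_mod_cast w₁.mult_pos),
      Real.log_pos_iff (Units.pos_at_place u w₁).le] at this
  refine ⟨u ^ S.index, Subgroup.pow_index_mem S u, ?_, fun w hw => ?_⟩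
  · push_cast
    rw [map_pow]
    exact one_lt_pow₀ hgt hS.index_ne_zero
  · push_cast
    rw [map_pow]
    exact pow_lt_one₀ (apply_nonneg _ _) (hlt w hw) hS.index_ne_zero

/-- Every `x > 0` can be multiplied into `[1, R)` by a natural power of `R`, if `x < R`. -/
theorem exists_pow_mul_mem_Ico {R x : ℝ} (hR : 1 < R) (hx : 0 < x) (hxR : x < R) :
    ∃ k : ℕ, 1 ≤ R ^ k * x ∧ R ^ k * x < R := by
  classical
  have hex : ∃ k : ℕ, 1 ≤ R ^ k * x := by
    obtain ⟨k, hk⟩ := pow_unbounded_of_one_lt x⁻¹ hR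
    exact ⟨k, by
      have := mul_le_mul_of_nonneg_right hk.le hx.le
      rwa [inv_mul_cancel₀ hx.ne'] at this⟩
  refine ⟨Nat.find hex, Nat.find_spec hex, ?_⟩
  rcases h : Nat.find hex with _ | k
  · simpa using hxR
  · have := Nat.find_min hex (m := k) (by omega)
    rw [not_le] at this
    calc R ^ (k + 1) * x = R * (R ^ k * x) := by ring
      _ < R * 1 := by gcongr
      _ = R := mul_one R

/-- With at least three infinite places, a subgroup of finite index of the units is not discrete
at any place. -/
theorem exists_unit_near_one (hcard : 3 ≤ Fintype.card (InfinitePlace K)) {S : Subgroup (𝓞 K)ˣ}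
    (hS : S.FiniteIndex) (w : InfinitePlace K) {δ : ℝ} (hδ : 0 < δ) :
    ∃ g ∈ S, w.embedding (g : K) ≠ 1 ∧ ‖w.embedding (g : K) - 1‖ < δ := by
  have : Nontrivial (InfinitePlace K) := Fintype.one_lt_card_iff_nontrivial.1 (by omega)
  obtain ⟨w₂, w₃, h2, h3, h23⟩ : ∃ w₂ w₃ : InfinitePlace K, w₂ ≠ w ∧ w₃ ≠ w ∧ w₃ ≠ w₂ := by
    classical
    obtain ⟨w₂, h2⟩ := exists_ne w
    obtain ⟨w₃, h3⟩ := Finset.exists_mem_notMem_of_card_lt_card (s := {w, w₂})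
      (t := (Finset.univ : Finset (InfinitePlace K)))
      ((Finset.card_le_two).trans_lt (by rw [Finset.card_univ]; omega))
    simp only [Finset.mem_univ, Finset.mem_insert, Finset.mem_singleton, not_or, true_and] at h3
    exact ⟨w₂, w₃, h2, h3.1, h3.2⟩
  obtain ⟨u, huS, hu, hu'⟩ := exists_unit_large_at_place hS w
  obtain ⟨b, hbS, -, hb'⟩ := exists_unit_large_at_place hS w₂
  -- The unit b is small at both w and w₃. A power of u restores the size at w and only shrinks the
  -- size at w₃, so as m grows there are infinitely many units of bounded size at w.
  have hbnd : ∀ m : ℕ, ∃ c ∈ S, (1 ≤ w (c : K) ∧ w (c : K) < w (u : K)) ∧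
      w₃ (c : K) ≤ w₃ (b : K) ^ m := by
    intro m
    obtain ⟨k, hk1, hk2⟩ := exists_pow_mul_mem_Ico hu (pow_pos (Units.pos_at_place b w) m)
      ((pow_le_one₀ (apply_nonneg _ _) (hb' w h2.symm).le).trans_lt hu)
    refine ⟨u ^ k * b ^ m, mul_mem (pow_mem huS k) (pow_mem hbS m), ?_, ?_⟩
    · push_cast
      rw [map_mul, map_pow, map_pow]
      exact ⟨hk1, hk2⟩
    · push_cast
      rw [map_mul, map_pow, map_pow]
      exact mul_le_of_le_one_left (pow_nonneg (apply_nonneg _ _) _)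
        (pow_le_one₀ (apply_nonneg _ _) (hu' w₃ h3).le)
  set C : Set (𝓞 K)ˣ := {c | c ∈ S ∧ 1 ≤ w (c : K) ∧ w (c : K) < w (u : K)}
  have hCinf : C.Infinite := by
    intro hfin
    obtain ⟨c₀, hc₀, hmin⟩ := hfin.exists_minimalFor (fun c : (𝓞 K)ˣ => w₃ (c : K)) C (by
      obtain ⟨c, hc, h, -⟩ := hbnd 0
      exact ⟨c, hc, h⟩)
    obtain ⟨m, hm⟩ := exists_pow_lt_of_lt_one (Units.pos_at_place c₀ w₃) (hb' w₃ h23)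
    obtain ⟨c, hc, h, hle⟩ := hbnd m
    have h1 := hmin (j := c) ⟨hc, h⟩ (hle.trans hm.le)
    exact absurd (h1.trans hle) (not_le.2 hm)
  have hinj : Function.Injective fun c : (𝓞 K)ˣ => w.embedding (c : K) :=
    w.embedding.injective.comp (Units.coe_injective K)
  have hinf : ((fun c : (𝓞 K)ˣ => w.embedding (c : K)) '' C).Infinite :=
    hCinf.image hinj.injOn
  obtain ⟨z, -, hz⟩ := hinf.exists_accPt_of_subset_isCompact
    (isCompact_closedBall (0 : ℂ) (w (u : K))) (by
      rintro _ ⟨c, hc, rfl⟩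
      rw [mem_closedBall_zero_iff, InfinitePlace.norm_embedding_eq]
      exact hc.2.2.le)
  rw [accPt_iff_nhds] at hz
  -- Two distinct values near z have a quotient near 1; dividing does not enlarge their difference
  -- because the denominator has absolute value at least 1.
  obtain ⟨_, ⟨hxb, c, hc, rfl⟩, hxz⟩ := hz _ (Metric.ball_mem_nhds z (half_pos hδ))
  obtain ⟨_, ⟨hyb, c', hc', rfl⟩, hyz⟩ := hz _ (inter_mem (Metric.ball_mem_nhds z (half_pos hδ))
    (isOpen_compl_singleton.mem_nhds hxz.symm))
  have hne : w.embedding (c' : K) ≠ 0 := norm_pos_iff.1 (norm_embedding_unit_pos w c')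
  have hnorm : 1 ≤ ‖w.embedding (c' : K)‖ := by
    rw [InfinitePlace.norm_embedding_eq]; exact hc'.2.1
  have hq : w.embedding ((c * c'⁻¹ : (𝓞 K)ˣ) : K) = w.embedding (c : K) / w.embedding (c' : K) := by
    rw [eq_div_iff hne, ← map_mul, ← Units.coe_mul, inv_mul_cancel_right]
  refine ⟨c * c'⁻¹, mul_mem hc.1 (inv_mem hc'.1), ?_, ?_⟩
  · rw [hq, Ne, div_eq_one_iff_eq hne]
    exact fun h => hyb.2 h.symm
  · rw [hq, div_sub_one hne, norm_div]
    refine (div_le_self (norm_nonneg _) hnorm).trans_lt ?_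
    rw [← dist_eq_norm]
    calc _ ≤ _ := dist_triangle_right _ _ z
      _ < δ / 2 + δ / 2 := add_lt_add hxb hyb.1
      _ = δ := add_halves δ

/-- If at a complex place there are real units that are large at any given place only, then the
field is CM. -/
theorem isCMField_of_real_units {w : InfinitePlace K} (hw : w.IsComplex)
    (h : ∀ w₁ : InfinitePlace K, ∃ u : (𝓞 K)ˣ, (1 < w₁ (u : K) ∧ ∀ w', w' ≠ w₁ → w' (u : K) < 1) ∧
      ComplexEmbedding.conjugate w.embedding (u : K) = w.embedding (u : K)) : IsCMField K := by
  let F : Subfield K := (ComplexEmbedding.conjugate w.embedding).eqLocusField w.embedding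
  have hF1 : Module.finrank F K ≠ 1 := by
    intro h1
    refine InfinitePlace.isComplex_iff.1 hw (RingHom.ext fun x => ?_)
    have hx : x ∈ (⊤ : Subalgebra F K) := trivial
    rw [← Subalgebra.bot_eq_top_iff_finrank_eq_one.2 h1] at hx
    obtain ⟨y, rfl⟩ := Algebra.mem_bot.1 hx
    exact y.2
  -- F contains a unit that is large at the place of φ only, so embeddings that agree on F lie over
  -- the same place of K.
  have hmk : ∀ φ ψ : K →+* ℂ, (∀ x ∈ F, ψ x = φ x) →
      ψ = φ ∨ ψ = ComplexEmbedding.conjugate φ := by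
    intro φ ψ hφψ
    by_cases heq : InfinitePlace.mk φ = InfinitePlace.mk ψ
    · rcases InfinitePlace.mk_eq_iff.1 heq with h | h
      · exact Or.inl h.symm
      · exact Or.inr h.symm
    · obtain ⟨u, ⟨h1, h2⟩, hu⟩ := h (InfinitePlace.mk φ)
      have h3 := h2 _ (Ne.symm heq)
      rw [InfinitePlace.apply] at h1 h3
      rw [hφψ _ hu] at h3
      exact absurd h3 h1.le.not_gt
  have hfin : 2 ≤ Module.finrank F K := by
    have : 0 < Module.finrank F K := Module.finrank_pos
    omega
  -- The restriction of φ to F has [K : F] ≥ 2 extensions, and only φ and its conjugate are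
  -- possible. So there are exactly two, they differ, and φ is real on F.
  have hconj : ∀ φ : K →+* ℂ, Module.finrank F K = 2 ∧ ComplexEmbedding.conjugate φ ≠ φ ∧
      ∀ x ∈ F, ComplexEmbedding.conjugate φ x = φ x := by
    intro φ
    let _ : Algebra F ℂ := (φ.comp (algebraMap F K)).toAlgebra
    have hcomm : ∀ ψ : K →ₐ[F] ℂ, ∀ x ∈ F, (ψ : K →+* ℂ) x = φ x := fun ψ x hx =>
      ψ.commutes ⟨x, hx⟩
    have hcard := AlgHom.card F K ℂ
    obtain ⟨ψ, hψ⟩ : ∃ ψ : K →ₐ[F] ℂ, (ψ : K →+* ℂ) ≠ φ := by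
      obtain ⟨ψ₁, ψ₂, hne⟩ := Fintype.one_lt_card_iff.1 (hcard ▸ hfin : 1 < _)
      by_contra! hall
      exact hne (AlgHom.coe_ringHom_injective ((hall ψ₁).trans (hall ψ₂).symm))
    have hψ' := (hmk φ ψ (hcomm ψ)).resolve_left hψ
    refine ⟨le_antisymm ?_ hfin, hψ' ▸ hψ, fun x hx => hψ' ▸ hcomm ψ x hx⟩
    classical
    rw [← hcard, ← Fintype.card_bool]
    refine Fintype.card_le_of_injective (fun ψ : K →ₐ[F] ℂ => decide ((ψ : K →+* ℂ) = φ)) ?_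
    intro ψ₁ ψ₂ h12
    simp only [decide_eq_decide] at h12
    refine AlgHom.coe_ringHom_injective ?_
    by_cases h1 : (ψ₁ : K →+* ℂ) = φ
    · exact h1.trans (h12.1 h1).symm
    · exact ((hmk φ _ (hcomm ψ₁)).resolve_left h1).trans
        ((hmk φ _ (hcomm ψ₂)).resolve_left (h12.not.1 h1)).symm
  have : IsTotallyComplex K := ⟨fun v => InfinitePlace.isComplex_iff.2 (hconj v.embedding).2.1⟩
  have : IsTotallyReal F := ⟨fun v => by
    obtain ⟨W, rfl⟩ := InfinitePlace.comap_surjective (K := K) v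
    dsimp only
    rw [← InfinitePlace.mk_embedding W, InfinitePlace.comap_mk, InfinitePlace.isReal_mk_iff,
      ComplexEmbedding.isReal_iff]
    exact RingHom.ext fun x => (hconj W.embedding).2.2 x x.2⟩
  have : Algebra.IsQuadraticExtension F K := ⟨(hconj w.embedding).1⟩
  exact IsCMField.ofCMExtension F K

/-- If `K` is not CM, the arguments of the units at a complex place are dense. -/
theorem exists_unit_direction [Nontrivial (InfinitePlace K)] (hCM : ¬ IsCMField K)
    {S : Subgroup (𝓞 K)ˣ} (hS : S.FiniteIndex) {w : InfinitePlace K} (hw : w.IsComplex) {z : ℂ}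
    (hz : ‖z‖ = 1) {δ : ℝ} (hδ : 0 < δ) :
    ∃ h ∈ S, ‖w.embedding (h : K) / ‖w.embedding (h : K)‖ - z‖ < δ := by
  have : Fact (0 < 2 * Real.pi) := ⟨Real.two_pi_pos⟩
  let f : (𝓞 K)ˣ → ℂ := fun h => w.embedding (h : K) / ‖w.embedding (h : K)‖
  have hfmul : ∀ h h', f (h * h') = f h * f h' := fun h h' => by
    simp only [f]
    push_cast
    rw [map_mul, norm_mul]
    push_cast
    rw [mul_div_mul_comm]
  have hfnorm : ∀ h, ‖f h‖ = 1 := fun h => by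
    simp only [f]
    rw [norm_div, Complex.norm_real, norm_norm, div_self (norm_embedding_unit_pos w h).ne']
  have hf1 : f 1 = 1 := by simp [f]
  let s : AddSubgroup (AddCircle (2 * Real.pi)) :=
    { carrier := {θ | ∃ h ∈ S, (AddCircle.toCircle θ : ℂ) = f h}
      zero_mem' := ⟨1, one_mem S, by simp [hf1]⟩
      add_mem' := by
        rintro a b ⟨h, hh, ha⟩ ⟨h', hh', hb⟩
        exact ⟨h * h', mul_mem hh hh', by
          rw [AddCircle.toCircle_add, Circle.coe_mul, ha, hb, hfmul]⟩
      neg_mem' := by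
        rintro a ⟨h, hh, ha⟩
        refine ⟨h⁻¹, inv_mem hh, ?_⟩
        rw [AddCircle.toCircle_neg, Circle.coe_inv, ha]
        refine inv_eq_of_mul_eq_one_right ?_
        rw [← hfmul, mul_inv_cancel, hf1] }
  have hdense : Dense (s : Set (AddCircle (2 * Real.pi))) := by
    -- A subgroup of the circle that is not dense is finite cyclic. A fixed power of every unit of S
    -- would then be real at w, which forces K to be CM.
    rw [AddCircle.dense_addSubgroup_iff_ne_zmultiples]
    rintro a ha hs
    refine hCM (isCMField_of_real_units hw fun w₁ => ?_)
    obtain ⟨u, huS, hu, hu'⟩ := exists_unit_large_at_place hS w₁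
    refine ⟨u ^ addOrderOf a, ⟨?_, fun w' hw' => ?_⟩, ?_⟩
    · push_cast
      rw [map_pow]
      exact one_lt_pow₀ hu ha
    · push_cast
      rw [map_pow]
      exact pow_lt_one₀ (apply_nonneg _ _) (hu' w' hw') ha
    · obtain ⟨θ, hθ⟩ := (AddCircle.homeomorphCircle (T := 2 * Real.pi) Real.two_pi_pos.ne').surjective
        ⟨f u, mem_sphere_zero_iff_norm.2 (hfnorm u)⟩
      have hθ' : (AddCircle.toCircle θ : ℂ) = f u := by
        rw [← AddCircle.homeomorphCircle_apply Real.two_pi_pos.ne', hθ]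
      have hmem : θ ∈ AddSubgroup.zmultiples a := hs ▸ (⟨u, huS, hθ'⟩ : θ ∈ s)
      have hNθ : addOrderOf a • θ = 0 := by
        obtain ⟨k, rfl⟩ := hmem
        simp only
        rw [smul_comm, addOrderOf_nsmul_eq_zero, smul_zero]
      have hfN : f u ^ addOrderOf a = 1 := by
        rw [← hθ', ← Circle.coe_pow, ← AddCircle.toCircle_nsmul, hNθ, AddCircle.toCircle_zero,
          Circle.coe_one]
      have hreal : w.embedding (u : K) ^ addOrderOf a =
          ((‖w.embedding (u : K)‖ ^ addOrderOf a : ℝ) : ℂ) := by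
        have hne : (‖w.embedding (u : K)‖ : ℂ) ≠ 0 := by
          exact_mod_cast (norm_embedding_unit_pos w u).ne'
        simp only [f, div_pow] at hfN
        rw [div_eq_one_iff_eq (pow_ne_zero _ hne)] at hfN
        rw [hfN]
        push_cast
        rfl
      rw [ComplexEmbedding.conjugate_coe_eq]
      push_cast
      rw [map_pow, hreal, Complex.conj_ofReal]
  obtain ⟨θ, hθ⟩ := (AddCircle.homeomorphCircle (T := 2 * Real.pi) Real.two_pi_pos.ne').surjective
    ⟨z, mem_sphere_zero_iff_norm.2 hz⟩
  have hθ' : (AddCircle.toCircle θ : ℂ) = z := by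
    rw [← AddCircle.homeomorphCircle_apply Real.two_pi_pos.ne', hθ]
  have hcont : Continuous fun θ : AddCircle (2 * Real.pi) => (AddCircle.toCircle θ : ℂ) :=
    continuous_subtype_val.comp AddCircle.continuous_toCircle
  obtain ⟨θ', ⟨h, hh, hθh⟩, hd⟩ := hdense.exists_mem_open
    (hcont.isOpen_preimage _ (Metric.isOpen_ball (x := z) (ε := δ)))
    ⟨θ, by simp [hθ', hδ]⟩
  refine ⟨h, hh, ?_⟩
  rw [Set.mem_preimage, Metric.mem_ball, dist_eq_norm, hθh] at hd
  exact hd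

end Units

/-! ### Coordinates and coordinate axes -/

section Coordinates

variable {K : Type*} [Field K]

open scoped Classical in
/-- The coordinate of a point of `ℝ^{r₁} ⊕ ℂ^{r₂}` at a place, as a complex number. -/
noncomputable def coord (w : InfinitePlace K) (x : mixedSpace K) : ℂ :=
  if hw : w.IsReal then (x.1 ⟨w, hw⟩ : ℂ)
  else x.2 ⟨w, InfinitePlace.not_isReal_iff_isComplex.1 hw⟩

open scoped Classical in
/-- The point with coordinate `z` (or its real part, at a real place) at `w`, and `0` elsewhere. -/
noncomputable def incl (w : InfinitePlace K) : ℂ →ₗ[ℝ] mixedSpace K where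
  toFun z := (fun v => if v.1 = w then z.re else 0, fun v => if v.1 = w then z else 0)
  map_add' x y := by
    ext v <;> by_cases h : v.1 = w <;> simp [h]
  map_smul' c x := by
    ext v <;> by_cases h : v.1 = w <;> simp [h]

theorem coord_of_isReal {w : InfinitePlace K} (hw : w.IsReal) (x : mixedSpace K) :
    coord w x = (x.1 ⟨w, hw⟩ : ℂ) := dif_pos hw

theorem coord_of_isComplex {w : InfinitePlace K} (hw : w.IsComplex) (x : mixedSpace K) :
    coord w x = x.2 ⟨w, hw⟩ := dif_neg (InfinitePlace.not_isReal_iff_isComplex.2 hw)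

theorem coord_im_of_isReal {w : InfinitePlace K} (hw : w.IsReal) (x : mixedSpace K) :
    (coord w x).im = 0 := by
  rw [coord_of_isReal hw, Complex.ofReal_im]

theorem norm_coord (w : InfinitePlace K) (x : mixedSpace K) : ‖coord w x‖ = normAtPlace w x := by
  rcases w.isReal_or_isComplex with hw | hw
  · rw [coord_of_isReal hw, normAtPlace_apply_of_isReal hw, Complex.norm_real]
  · rw [coord_of_isComplex hw, normAtPlace_apply_of_isComplex hw]

theorem coord_mul (w : InfinitePlace K) (x y : mixedSpace K) :
    coord w (x * y) = coord w x * coord w y := by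
  rcases w.isReal_or_isComplex with hw | hw
  · simp [coord_of_isReal hw]
  · simp [coord_of_isComplex hw]

theorem coord_mixedEmbedding (w : InfinitePlace K) (a : K) :
    coord w (mixedEmbedding K a) = w.embedding a := by
  rcases w.isReal_or_isComplex with hw | hw
  · rw [coord_of_isReal hw, mixedEmbedding_apply_isReal, InfinitePlace.embedding_of_isReal_apply]
  · rw [coord_of_isComplex hw, mixedEmbedding_apply_isComplex]

theorem mul_incl (w : InfinitePlace K) (x : mixedSpace K) (z : ℂ) :
    x * incl w z = incl w (coord w x * z) := by
  ext v
  · by_cases h : v.1 = w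
    · subst h
      simp [incl, coord_of_isReal v.2]
    · simp [incl, h]
  · by_cases h : v.1 = w
    · subst h
      simp [incl, coord_of_isComplex v.2]
    · simp [incl, h]

theorem incl_coord {w : InfinitePlace K} {x : mixedSpace K}
    (hx : ∀ v, v ≠ w → normAtPlace v x = 0) : incl w (coord w x) = x := by
  ext v
  · by_cases h : v.1 = w
    · subst h
      simp [incl, coord_of_isReal v.2]
    · have := hx v.1 h
      rw [← norm_coord, norm_eq_zero, coord_of_isReal v.2, Complex.ofReal_eq_zero] at this
      simp [incl, h, this]
  · by_cases h : v.1 = w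
    · subst h
      simp [incl, coord_of_isComplex v.2]
    · have := hx v.1 h
      rw [← norm_coord, norm_eq_zero, coord_of_isComplex v.2] at this
      simp [incl, h, this]

theorem continuous_incl (w : InfinitePlace K) : Continuous (incl w) :=
  (incl w).continuous_of_finiteDimensional

variable [NumberField K]

theorem pairing_incl (w : InfinitePlace K) (ξ : mixedSpace K) (z : ℂ) :
    pairing ξ (incl w z) = w.mult * (coord w ξ * z).re := by
  classical
  rcases w.isReal_or_isComplex with hw | hw
  · have h1 : ∀ v : {v : InfinitePlace K // v.IsReal}, v.1 = w ↔ v = ⟨w, hw⟩ := fun v =>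
      ⟨fun h => Subtype.ext h, fun h => congrArg Subtype.val h⟩
    have h2 : ∀ v : {v : InfinitePlace K // v.IsComplex}, v.1 ≠ w := fun v h =>
      InfinitePlace.not_isReal_iff_isComplex.2 v.2 (h ▸ hw)
    simp [pairing, incl, h1, h2, coord_of_isReal hw, InfinitePlace.mult, hw]
  · have h1 : ∀ v : {v : InfinitePlace K // v.IsComplex}, v.1 = w ↔ v = ⟨w, hw⟩ := fun v =>
      ⟨fun h => Subtype.ext h, fun h => congrArg Subtype.val h⟩
    have h2 : ∀ v : {v : InfinitePlace K // v.IsReal}, v.1 ≠ w := fun v h =>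
      InfinitePlace.not_isReal_iff_isComplex.2 hw (h ▸ v.2)
    simp only [pairing, incl, LinearMap.coe_mk, AddHom.coe_mk, AddMonoidHom.coe_mk,
      ZeroHom.coe_mk, h1, h2, if_false, mul_zero, Finset.sum_const_zero, zero_add, mul_ite,
      coord_of_isComplex hw, InfinitePlace.mult, InfinitePlace.not_isReal_iff_isComplex.2 hw]
    rw [Finset.sum_eq_single ⟨w, hw⟩ (fun v _ hv => by simp [hv]) (by simp)]
    simp

theorem continuous_pairing (ξ : mixedSpace K) : Continuous (pairing ξ) := by
  classical
  change Continuous fun x : mixedSpace K => ∑ w, ξ.1 w * x.1 w + ∑ w, 2 * (ξ.2 w * x.2 w).re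
  fun_prop

end Coordinates

/-! ### Directions of small displacements along an axis -/

section Directions

variable {K : Type*} [Field K] [NumberField K]

/-- Moving `z` by large units `h` and then by units `h g`, with `g` near `1`, gives displacements
that tend to zero slowly in the direction `u`. -/
def IsTangentDirection (S : Subgroup (𝓞 K)ˣ) (w : InfinitePlace K) (z u : ℂ) : Prop :=
  ∀ η > 0, ∃ h ∈ S, ∃ g ∈ S,
    w.embedding (h : K) * (w.embedding (g : K) - 1) * z ≠ 0 ∧
    ‖w.embedding (h : K) * (w.embedding (g : K) - 1) * z‖ < η ∧
    ‖w.embedding (g : K) - 1‖ ≤ η * ‖w.embedding (h : K) * (w.embedding (g : K) - 1) * z‖ ∧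
    ‖w.embedding (h : K) * (w.embedding (g : K) - 1) * z /
      ‖w.embedding (h : K) * (w.embedding (g : K) - 1) * z‖ - u‖ < η

/-- The unit h is chosen first, so large at w that |g - 1| is negligible against |h (g - 1) z| for
every g; then g is chosen close enough to 1, depending on h. The factor M leaves room for
multiplying h by a unit from a fixed finite set. -/
theorem exists_small_displacement (hcard : 3 ≤ Fintype.card (InfinitePlace K))
    {S : Subgroup (𝓞 K)ˣ} (hS : S.FiniteIndex) (w : InfinitePlace K) {z : ℂ} (hz : z ≠ 0)
    {η M : ℝ} (hη : 0 < η) (hM : 1 ≤ M) :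
    ∃ h ∈ S, ∃ g ∈ S, w.embedding (h : K) * (w.embedding (g : K) - 1) * z ≠ 0 ∧
      M * ‖w.embedding (h : K) * (w.embedding (g : K) - 1) * z‖ < η ∧
      M * ‖w.embedding (g : K) - 1‖ ≤ η * ‖w.embedding (h : K) * (w.embedding (g : K) - 1) * z‖ := by
  have : Nontrivial (InfinitePlace K) := Fintype.one_lt_card_iff_nontrivial.1 (by omega)
  have hz' : 0 < ‖z‖ := norm_pos_iff.2 hz
  obtain ⟨b, hbS, hb, -⟩ := exists_unit_large_at_place hS w
  obtain ⟨n, hn⟩ := pow_unbounded_of_one_lt (M / (η * ‖z‖)) hb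
  set h := b ^ n with hh
  have hnorm : M / (η * ‖z‖) < ‖w.embedding (h : K)‖ := by
    rw [InfinitePlace.norm_embedding_eq, hh]
    push_cast
    rwa [map_pow]
  have hpos := norm_embedding_unit_pos w h
  obtain ⟨g, hgS, hg1, hg⟩ := exists_unit_near_one hcard hS w
    (δ := η / (M * ‖w.embedding (h : K)‖ * ‖z‖)) (by positivity)
  refine ⟨h, pow_mem hbS n, g, hgS,
    mul_ne_zero (mul_ne_zero (norm_pos_iff.1 hpos) (sub_ne_zero.2 hg1)) hz, ?_, ?_⟩
  · rw [lt_div_iff₀ (by positivity)] at hg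
    rw [norm_mul, norm_mul]
    linarith
  · rw [div_lt_iff₀ (by positivity)] at hnorm
    rw [norm_mul, norm_mul]
    calc M * ‖w.embedding (g : K) - 1‖
        ≤ ‖w.embedding (h : K)‖ * (η * ‖z‖) * ‖w.embedding (g : K) - 1‖ := by gcongr
      _ = _ := by ring

/-- At a real place displacements are real, so their direction is a sign. If both signs failed, a
displacement that is small for the smaller of the two tolerances would contradict one of the
failures. -/
theorem isTangentDirection_of_isReal (hcard : 3 ≤ Fintype.card (InfinitePlace K))
    {S : Subgroup (𝓞 K)ˣ} (hS : S.FiniteIndex) {w : InfinitePlace K} (hw : w.IsReal) {z : ℂ}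
    (hz : z ≠ 0) (hzim : z.im = 0) :
    IsTangentDirection S w z 1 ∨ IsTangentDirection S w z (-1) := by
  by_contra! hcon
  simp only [IsTangentDirection, not_forall] at hcon
  obtain ⟨⟨η₁, hη₁, h1⟩, ⟨η₂, hη₂, h2⟩⟩ := hcon
  obtain ⟨h, hh, g, hg, hq, hq1, hq2⟩ := exists_small_displacement hcard hS w hz
    (lt_min hη₁ hη₂) le_rfl
  rw [one_mul] at hq1 hq2
  have hreal : ∀ a : K, w.embedding a = ((w.embedding a).re : ℂ) := fun a => by
    rw [← coord_mixedEmbedding, coord_of_isReal hw, Complex.ofReal_re]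
  obtain ⟨x, hx⟩ : ∃ x : ℝ, w.embedding (h : K) * (w.embedding (g : K) - 1) * z = x :=
    ⟨(w.embedding (h : K)).re * ((w.embedding (g : K)).re - 1) * z.re, by
      rw [hreal (h : K), hreal (g : K), show z = (z.re : ℂ) from Complex.ext rfl (by simp [hzim])]
      push_cast
      rfl⟩
  rw [hx] at hq hq1 hq2
  have hx0 : x ≠ 0 := by simpa using hq
  rcases hx0.lt_or_gt with hneg | hpos
  · refine h2 ⟨h, hh, g, hg, ?_⟩
    rw [hx]
    refine ⟨hq, hq1.trans_le (min_le_right _ _), hq2.trans (by gcongr; exact min_le_right _ _), ?_⟩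
    rw [Complex.norm_real, Real.norm_eq_abs, abs_of_neg hneg]
    push_cast
    rw [div_neg, div_self hq, sub_self, norm_zero]
    exact hη₂
  · refine h1 ⟨h, hh, g, hg, ?_⟩
    rw [hx]
    refine ⟨hq, hq1.trans_le (min_le_left _ _), hq2.trans (by gcongr; exact min_le_left _ _), ?_⟩
    rw [Complex.norm_real, Real.norm_eq_abs, abs_of_pos hpos, div_self hq, sub_self, norm_zero]
    exact hη₁

/-- Density of the arguments of units lets any displacement be rotated into the direction u. By
compactness finitely many rotating units suffice, so their sizes are bounded by some M before the
displacement is chosen. -/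
theorem isTangentDirection_of_isComplex (hcard : 3 ≤ Fintype.card (InfinitePlace K))
    (hCM : ¬ IsCMField K) {S : Subgroup (𝓞 K)ˣ} (hS : S.FiniteIndex) {w : InfinitePlace K}
    (hw : w.IsComplex) {z u : ℂ} (hz : z ≠ 0) (hu : ‖u‖ = 1) : IsTangentDirection S w z u := by
  intro η hη
  have : Nontrivial (InfinitePlace K) := Fintype.one_lt_card_iff_nontrivial.1 (by omega)
  let dir : (𝓞 K)ˣ → ℂ := fun e => w.embedding (e : K) / ‖w.embedding (e : K)‖
  obtain ⟨E, hES, hEfin, hcov⟩ := (isCompact_sphere (0 : ℂ) 1).elim_finite_subcover_image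
    (b := (S : Set (𝓞 K)ˣ)) (c := fun e => Metric.ball (dir e) η) (fun _ _ => Metric.isOpen_ball)
    (fun d hd => by
      obtain ⟨e, he, hde⟩ := exists_unit_direction hCM hS hw (mem_sphere_zero_iff_norm.1 hd) hη
      exact Set.mem_biUnion he (by rwa [Metric.mem_ball, dist_comm, dist_eq_norm]))
  obtain ⟨M, hM⟩ := (hEfin.image fun e : (𝓞 K)ˣ =>
    max ‖w.embedding (e : K)‖ ‖w.embedding (e : K)‖⁻¹).bddAbove
  have hME : ∀ e ∈ E, ‖w.embedding (e : K)‖ ≤ max 1 M ∧ ‖w.embedding (e : K)‖⁻¹ ≤ max 1 M :=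
    fun e he => by
      have := (hM (Set.mem_image_of_mem _ he)).trans (le_max_right 1 M)
      exact max_le_iff.1 this
  obtain ⟨h, hh, g, hg, hq, hq1, hq2⟩ := exists_small_displacement hcard hS w hz hη
    (le_max_left 1 M)
  set q := w.embedding (h : K) * (w.embedding (g : K) - 1) * z with hqdef
  have hq0 : 0 < ‖q‖ := norm_pos_iff.2 hq
  have hqC : (‖q‖ : ℂ) ≠ 0 := by exact_mod_cast hq0.ne'
  have hd1 : ‖q / ‖q‖‖ = 1 := by
    rw [norm_div, Complex.norm_real, norm_norm, div_self hq0.ne']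
  have hdmem : u / (q / ‖q‖) ∈ Metric.sphere (0 : ℂ) 1 := by
    rw [mem_sphere_zero_iff_norm, norm_div, hu, hd1, div_one]
  obtain ⟨e, he, hed⟩ := Set.mem_iUnion₂.1 (hcov hdmem)
  have he0 := norm_embedding_unit_pos w e
  have hprod : w.embedding ((e * h : (𝓞 K)ˣ) : K) * (w.embedding (g : K) - 1) * z =
      w.embedding (e : K) * q := by
    rw [Units.coe_mul, map_mul, hqdef]
    ring
  refine ⟨e * h, mul_mem (hES he) hh, g, hg, ?_⟩
  rw [hprod]
  refine ⟨mul_ne_zero (norm_pos_iff.1 he0) hq, ?_, ?_, ?_⟩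
  · rw [norm_mul]
    exact (mul_le_mul_of_nonneg_right (hME e he).1 hq0.le).trans_lt hq1
  · have h3 : ‖w.embedding (e : K)‖⁻¹ * ‖w.embedding (g : K) - 1‖ ≤ η * ‖q‖ :=
      (mul_le_mul_of_nonneg_right (hME e he).2 (norm_nonneg _)).trans hq2
    rw [inv_mul_le_iff₀ he0] at h3
    rw [norm_mul]
    linarith
  · rw [Metric.mem_ball, dist_comm, dist_eq_norm] at hed
    have : w.embedding (e : K) * q / ‖w.embedding (e : K) * q‖ - u =
        (dir e - u / (q / ‖q‖)) * (q / ‖q‖) := by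
      rw [sub_mul, div_mul_cancel₀ _ (div_ne_zero hq hqC), norm_mul]
      push_cast
      simp only [dir]
      rw [mul_div_mul_comm]
    rw [this, norm_mul, hd1, mul_one]
    exact hed

/-- Some tangent direction is not orthogonal to any of countably many nonzero vectors. -/
theorem exists_isTangentDirection_re_ne_zero (hcard : 3 ≤ Fintype.card (InfinitePlace K))
    (hCM : ¬ IsCMField K) {S : Subgroup (𝓞 K)ˣ} (hS : S.FiniteIndex) (w : InfinitePlace K) {z : ℂ}
    (hz : z ≠ 0) (hzim : w.IsReal → z.im = 0) {D : Set (mixedSpace K)} (hD : D.Countable)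
    (hD0 : ∀ ξ ∈ D, coord w ξ ≠ 0) :
    ∃ u, IsTangentDirection S w z u ∧ ∀ ξ ∈ D, (coord w ξ * u).re ≠ 0 := by
  rcases w.isReal_or_isComplex with hw | hw
  · have hre : ∀ ξ ∈ D, (coord w ξ).re ≠ 0 := fun ξ hξ h =>
      hD0 ξ hξ (Complex.ext h (coord_im_of_isReal hw ξ))
    rcases isTangentDirection_of_isReal hcard hS hw hz (hzim hw) with h | h
    · exact ⟨1, h, fun ξ hξ => by simpa using hre ξ hξ⟩
    · exact ⟨-1, h, fun ξ hξ => by simpa using hre ξ hξ⟩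
  · obtain ⟨s, hs⟩ : ∃ s : ℝ, s ∉ (fun ξ => (coord w ξ).re / (coord w ξ).im) '' D := by
      by_contra! hall
      exact Set.not_countable_univ ((hD.image _).mono fun s _ => hall s)
    set u₀ : ℂ := ⟨1, s⟩ with hu₀
    have hu0 : 0 < ‖u₀‖ := norm_pos_iff.2 fun h => by simpa [hu₀] using congrArg Complex.re h
    refine ⟨(‖u₀‖⁻¹ : ℝ) • u₀, isTangentDirection_of_isComplex hcard hCM hS hw hz ?_, ?_⟩
    · rw [_root_.norm_smul, norm_inv, norm_norm, inv_mul_cancel₀ hu0.ne']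
    · intro ξ hξ
      rw [mul_smul_comm, Complex.smul_re, smul_eq_mul]
      refine mul_ne_zero (inv_ne_zero hu0.ne') ?_
      rw [Complex.mul_re]
      simp only [hu₀, mul_one]
      intro h
      by_cases him : (coord w ξ).im = 0
      · rw [him, zero_mul, sub_zero] at h
        exact hD0 ξ hξ (Complex.ext h him)
      · exact hs ⟨ξ, hξ, by
          rw [div_eq_iff him]
          linarith⟩

end Directions

/-! ### Iterating a small step -/

section Limits

theorem norm_pow_sub_one_le (g : ℂ) (j : ℕ) : ‖g ^ j - 1‖ ≤ (1 + ‖g - 1‖) ^ j - 1 := by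
  have hg : ‖g‖ ≤ 1 + ‖g - 1‖ := by
    calc ‖g‖ = ‖1 + (g - 1)‖ := by ring_nf
      _ ≤ ‖(1 : ℂ)‖ + ‖g - 1‖ := norm_add_le _ _
      _ = _ := by rw [norm_one]
  induction j with
  | zero => simp
  | succ j ih =>
    calc ‖g ^ (j + 1) - 1‖ = ‖(g ^ j - 1) * g + (g - 1)‖ := by ring_nf
      _ ≤ ‖g ^ j - 1‖ * ‖g‖ + ‖g - 1‖ := (norm_add_le _ _).trans_eq (by rw [norm_mul])
      _ ≤ ((1 + ‖g - 1‖) ^ j - 1) * (1 + ‖g - 1‖) + ‖g - 1‖ := by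
        gcongr
        exact (norm_nonneg _).trans ih
      _ = _ := by ring

/-- With m = ⌊t/|q|⌋, the displacement a (g^m - 1) is q (1 + g + ⋯ + g^(m-1)). Since m |g - 1| ≤ ηt,
every power occurring is within exp(ηt) - 1 of 1, so the sum is close to mq; rounding t/|q| costs at
most |q|. -/
theorem norm_mul_pow_sub_one_sub_le {a g q : ℂ} {η t : ℝ} (hη : 0 ≤ η) (hq : a * (g - 1) = q)
    (hq0 : q ≠ 0) (hg : ‖g - 1‖ ≤ η * ‖q‖) (ht : 0 ≤ t) :
    ‖a * (g ^ ⌊t / ‖q‖⌋₊ - 1) - t * (q / ‖q‖)‖ ≤ t * (Real.exp (η * t) - 1) + ‖q‖ := by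
  set m := ⌊t / ‖q‖⌋₊
  have hqpos : 0 < ‖q‖ := norm_pos_iff.2 hq0
  have hqC : (‖q‖ : ℂ) ≠ 0 := by exact_mod_cast hqpos.ne'
  have hm1 : m * ‖q‖ ≤ t := (le_div_iff₀ hqpos).1 (Nat.floor_le (by positivity))
  have hm2 : t < (m + 1) * ‖q‖ := (div_lt_iff₀ hqpos).1 (Nat.lt_floor_add_one _)
  have hgeom : a * (g ^ m - 1) = q * ∑ j ∈ Finset.range m, g ^ j := by
    rw [← mul_geom_sum, ← mul_assoc, hq]
  have hpow : ∀ j ∈ Finset.range m, ‖g ^ j - 1‖ ≤ Real.exp (η * t) - 1 := by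
    intro j hj
    refine (norm_pow_sub_one_le g j).trans (sub_le_sub_right ?_ 1)
    have hjm : (j : ℝ) ≤ m := by exact_mod_cast (Finset.mem_range.1 hj).le
    calc (1 + ‖g - 1‖) ^ j ≤ Real.exp ‖g - 1‖ ^ j := by
          gcongr
          linarith [Real.add_one_le_exp ‖g - 1‖]
      _ = Real.exp (j * ‖g - 1‖) := (Real.exp_nat_mul _ _).symm
      _ ≤ Real.exp (η * t) := by
        refine Real.exp_le_exp.2 ?_
        calc (j : ℝ) * ‖g - 1‖ ≤ m * (η * ‖q‖) := by gcongr
          _ = η * (m * ‖q‖) := by ring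
          _ ≤ η * t := by gcongr
  have h1 : ‖q * ∑ j ∈ Finset.range m, g ^ j - m * q‖ ≤ t * (Real.exp (η * t) - 1) := by
    have : q * ∑ j ∈ Finset.range m, g ^ j - m * q =
        q * ∑ j ∈ Finset.range m, (g ^ j - 1) := by
      rw [Finset.sum_sub_distrib]
      simp
      ring
    rw [this, norm_mul]
    calc ‖q‖ * ‖∑ j ∈ Finset.range m, (g ^ j - 1)‖
        ≤ ‖q‖ * (m * (Real.exp (η * t) - 1)) := by
          gcongr
          exact (norm_sum_le_of_le _ hpow).trans_eq (by simp [mul_sub])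
      _ = (m * ‖q‖) * (Real.exp (η * t) - 1) := by ring
      _ ≤ _ := by
        gcongr
        linarith [Real.one_le_exp (by positivity : 0 ≤ η * t)]
  have h2 : ‖(m : ℂ) * q - t * (q / ‖q‖)‖ ≤ ‖q‖ := by
    have : (m : ℂ) * q - t * (q / ‖q‖) = ((m * ‖q‖ - t : ℝ) : ℂ) * (q / ‖q‖) := by
      push_cast
      field_simp
    rw [this, norm_mul, norm_div, Complex.norm_real, Complex.norm_real, norm_norm,
      div_self hqpos.ne', mul_one, Real.norm_eq_abs, abs_le]
    constructor <;> linarith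
  calc _ = ‖(q * ∑ j ∈ Finset.range m, g ^ j - m * q) + ((m : ℂ) * q - t * (q / ‖q‖))‖ := by
        rw [hgeom]; ring_nf
    _ ≤ _ := (norm_add_le _ _).trans (add_le_add h1 h2)

end Limits

/-! ### Invariant sets that accumulate at 0 -/

/-- A topological group presented as a quotient of `ℝ^{r₁} ⊕ ℂ^{r₂}`, with a separating group of
characters given by elements of `K`. -/
structure QuotientPresentation (K : Type*) [Field K] [NumberField K] (Y : Type*) [AddCommGroup Y]
    [TopologicalSpace Y] where
  /-- The quotient map. -/
  proj : mixedSpace K →+ Y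
  continuous_proj : Continuous proj
  surjective_proj : Function.Surjective proj
  isOpenMap_proj : IsOpenMap proj
  /-- The group of frequencies. -/
  freq : AddSubgroup (mixedSpace K)
  freq_le : ∀ ξ ∈ freq, ∃ a : K, mixedEmbedding K a = ξ
  /-- The character of a frequency. -/
  character : freq →+ Y →+ UnitAddCircle
  character_proj : ∀ ξ x, character ξ (proj x) = ((pairing ξ.1 x : ℝ) : UnitAddCircle)
  separates : ∀ y, y ≠ 0 → ∃ ξ, character ξ y ≠ 0

namespace QuotientPresentation

variable {K : Type*} [Field K] [NumberField K] {Y : Type*} [AddCommGroup Y] [TopologicalSpace Y]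
  (Q : QuotientPresentation K Y)

theorem continuous_character (ξ : Q.freq) : Continuous (Q.character ξ) := by
  rw [(Q.isOpenMap_proj.isQuotientMap Q.continuous_proj Q.surjective_proj).continuous_iff]
  have : Q.character ξ ∘ Q.proj = fun x => ((pairing ξ.1 x : ℝ) : UnitAddCircle) :=
    funext fun x => Q.character_proj ξ x
  rw [this]
  exact (AddCircle.continuous_mk' 1).comp (continuous_pairing _)

theorem countable_freq : (Q.freq : Set (mixedSpace K)).Countable := by
  have : Countable K := (Module.Free.chooseBasis ℚ K).repr.toEquiv.injective.countable
  exact (Set.countable_range (mixedEmbedding K)).mono fun ξ hξ => Q.freq_le ξ hξ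

/-- Frequencies come from the field K, whose embeddings are injective. This is the irreducibility
that lets a single axis suffice. -/
theorem coord_ne_zero {ξ : mixedSpace K} (hξ : ξ ∈ Q.freq) (h0 : ξ ≠ 0) (w : InfinitePlace K) :
    coord w ξ ≠ 0 := by
  obtain ⟨a, rfl⟩ := Q.freq_le ξ hξ
  rw [coord_mixedEmbedding]
  exact fun h => h0 (by rw [(map_eq_zero _).1 h, map_zero])

/-- A closed invariant set that accumulates at `0` contains a nonzero point of a coordinate axis. -/
theorem exists_incl_mem [Nontrivial (InfinitePlace K)] {S : Subgroup (𝓞 K)ˣ} (hS : S.FiniteIndex)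
    {A : Set Y} (hA : IsClosed A)
    (hinv : ∀ u ∈ S, ∀ x, Q.proj x ∈ A → Q.proj (mixedEmbedding K (u : K) * x) ∈ A)
    (hacc : AccPt 0 (𝓟 A)) :
    ∃ (w : InfinitePlace K) (z : ℂ), z ≠ 0 ∧ (w.IsReal → z.im = 0) ∧ Q.proj (incl w z) ∈ A := by
  classical
  choose b hbS hb hb' using fun w => exists_unit_large_at_place hS w
  -- Take a tiny lift of a nonzero point of A and a place w where it does not vanish. A power of the
  -- unit that is large only at w brings that coordinate to size about 1 and shrinks all the others.
  have hex : ∀ δ : ℝ, 0 < δ → ∃ w, ∃ x, Q.proj x ∈ A ∧ 1 ≤ normAtPlace w x ∧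
      normAtPlace w x ≤ w (b w : K) ∧ ∀ v, v ≠ w → normAtPlace v x ≤ δ := by
    intro δ hδ
    have hU : Q.proj '' Metric.ball 0 (min δ 1) ∈ 𝓝 (0 : Y) := by
      rw [← map_zero Q.proj]
      exact Q.isOpenMap_proj.image_mem_nhds (Metric.ball_mem_nhds _ (lt_min hδ one_pos))
    rw [accPt_iff_nhds] at hacc
    obtain ⟨_, ⟨⟨x, hx, rfl⟩, hxA⟩, hx0⟩ := hacc _ hU
    rw [mem_ball_zero_iff] at hx
    have hle : ∀ v, normAtPlace v x ≤ ‖x‖ := fun v => by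
      rw [norm_eq_sup'_normAtPlace]
      exact Finset.le_sup' (fun v => normAtPlace v x) (Finset.mem_univ v)
    obtain ⟨w, hw⟩ := exists_normAtPlace_ne_zero_iff.2 fun h : x = 0 => hx0 (by rw [h, map_zero])
    have hwpos : 0 < normAtPlace w x := (normAtPlace_nonneg w x).lt_of_ne' hw
    obtain ⟨k, hk1, hk2⟩ := exists_pow_mul_mem_Ico (hb w) hwpos
      (((hle w).trans_lt (hx.trans_le (min_le_right _ _))).trans (hb w))
    have hval : ∀ v, normAtPlace v (mixedEmbedding K ((b w ^ k : (𝓞 K)ˣ) : K) * x) =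
        v (b w : K) ^ k * normAtPlace v x := fun v => by
      push_cast
      rw [map_mul, normAtPlace_apply, map_pow]
    refine ⟨w, _, hinv _ (pow_mem (hbS w) k) x hxA, ?_, ?_, fun v hv => ?_⟩
    · rwa [hval]
    · rw [hval]; exact hk2.le
    · rw [hval]
      calc v (b w : K) ^ k * normAtPlace v x ≤ 1 * δ := by
            gcongr
            · exact normAtPlace_nonneg v x
            · exact pow_le_one₀ (apply_nonneg _ _) (hb' w v hv).le
            · exact (hle v).trans (hx.le.trans (min_le_left _ _))
        _ = δ := one_mul δ
  -- Pigeonhole over the finitely many places makes w independent of δ.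
  obtain ⟨w, hw⟩ : ∃ w, ∀ δ : ℝ, 0 < δ → ∃ x, Q.proj x ∈ A ∧ 1 ≤ normAtPlace w x ∧
      normAtPlace w x ≤ w (b w : K) ∧ ∀ v, v ≠ w → normAtPlace v x ≤ δ := by
    by_contra! hcon
    choose δ hδ hcon using hcon
    obtain ⟨w₀, hw₀⟩ := Finite.exists_min δ
    obtain ⟨w, x, hxA, h1, h2, h3⟩ := hex (δ w₀) (hδ w₀)
    obtain ⟨v, hv, hlt⟩ := hcon w x hxA h1 h2
    exact absurd ((h3 v hv).trans (hw₀ w)) hlt.not_ge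
  choose! x hxA hx1 hx2 hx3 using hw
  set η : ℕ → ℝ := fun k => 1 / ((k : ℝ) + 1) with hη
  have hη0 : ∀ k, 0 < η k := fun k => Nat.one_div_pos_of_nat
  have hη1 : ∀ k, η k ≤ 1 := fun k => by
    rw [hη]
    exact (div_le_one (by positivity)).2 (by linarith [(Nat.cast_nonneg k : (0 : ℝ) ≤ k)])
  have hηlim : Tendsto η atTop (𝓝 0) := tendsto_one_div_add_atTop_nhds_zero_nat
  have hbdd : ∀ k, x (η k) ∈ Metric.closedBall (0 : mixedSpace K) (w (b w : K)) := fun k => by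
    rw [mem_closedBall_zero_iff, norm_eq_sup'_normAtPlace]
    refine Finset.sup'_le _ _ fun v _ => ?_
    by_cases hv : v = w
    · rw [hv]; exact hx2 _ (hη0 k)
    · exact (hx3 _ (hη0 k) v hv).trans ((hη1 k).trans (hb w).le)
  obtain ⟨y, -, φ, hφ, hlim⟩ := (isCompact_closedBall _ _).tendsto_subseq hbdd
  have hnorm : ∀ v, Tendsto (fun k => normAtPlace v (x (η (φ k)))) atTop (𝓝 (normAtPlace v y)) :=
    fun v => ((continuous_normAtPlace v).tendsto y).comp hlim
  have hy0 : ∀ v, v ≠ w → normAtPlace v y = 0 := fun v hv =>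
    le_antisymm (le_of_tendsto_of_tendsto' (hnorm v) (hηlim.comp hφ.tendsto_atTop)
      fun k => hx3 _ (hη0 _) v hv) (normAtPlace_nonneg v y)
  refine ⟨w, coord w y, ?_, fun hwr => coord_im_of_isReal hwr y, ?_⟩
  · rw [← norm_pos_iff, norm_coord]
    exact one_pos.trans_le (ge_of_tendsto' (hnorm w) fun k => hx1 _ (hη0 _))
  · rw [incl_coord hy0]
    exact hA.mem_of_tendsto ((Q.continuous_proj.tendsto y).comp hlim)
      (Eventually.of_forall fun k => hxA _ (hη0 _))

variable [IsTopologicalAddGroup Y] [CompactSpace Y]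

/-- A closed invariant set that contains a point on a coordinate axis contains a translate of the
ray in each tangent direction. -/
theorem exists_ray_subset {S : Subgroup (𝓞 K)ˣ} {A : Set Y} (hA : IsClosed A)
    (hinv : ∀ u ∈ S, ∀ x, Q.proj x ∈ A → Q.proj (mixedEmbedding K (u : K) * x) ∈ A)
    {w : InfinitePlace K} {z u : ℂ} (hz : Q.proj (incl w z) ∈ A)
    (hu : IsTangentDirection S w z u) :
    ∃ y, ∀ t : ℝ, 0 ≤ t → y + Q.proj (incl w (t * u)) ∈ A := by
  choose! h hS g gS hq hq1 hq2 hq3 using hu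
  set η : ℕ → ℝ := fun k => 1 / ((k : ℝ) + 1) with hη
  have hη0 : ∀ k, 0 < η k := fun k => Nat.one_div_pos_of_nat
  have hηlim : Tendsto η atTop (𝓝 0) := tendsto_one_div_add_atTop_nhds_zero_nat
  set a : ℕ → ℂ := fun k => w.embedding (h (η k) : K) * z with ha
  set G : ℕ → ℂ := fun k => w.embedding (g (η k) : K) with hG
  set q : ℕ → ℂ := fun k => w.embedding (h (η k) : K) * (w.embedding (g (η k) : K) - 1) * z
    with hqd
  have haq : ∀ k, a k * (G k - 1) = q k := fun k => by simp only [ha, hG, hqd]; ring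
  have hqlim : Tendsto (fun k => ‖q k‖) atTop (𝓝 0) :=
    squeeze_zero (fun _ => norm_nonneg _) (fun k => (hq1 _ (hη0 k)).le) hηlim
  have hulim : Tendsto (fun k => q k / ‖q k‖) atTop (𝓝 u) := by
    rw [tendsto_iff_norm_sub_tendsto_zero]
    exact squeeze_zero (fun _ => norm_nonneg _) (fun k => (hq3 _ (hη0 k)).le) hηlim
  -- The ultrafilter is fixed before t, so that the base points h_k z have one limit y serving the
  -- whole ray.
  let 𝒰 : Ultrafilter ℕ := Ultrafilter.of atTop
  have h𝒰 : (𝒰 : Filter ℕ) ≤ atTop := Ultrafilter.of_le atTop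
  obtain ⟨y, -, hy⟩ := isCompact_univ.ultrafilter_le_nhds
    (𝒰.map fun k => Q.proj (incl w (a k))) (by simp)
  refine ⟨y, fun t ht => ?_⟩
  set m : ℕ → ℕ := fun k => ⌊t / ‖q k‖⌋₊
  have hlim : Tendsto (fun k => a k * (G k ^ m k - 1)) atTop (𝓝 (t * u)) := by
    have h1 : Tendsto (fun k => t * (Real.exp (η k * t) - 1) + ‖q k‖) atTop (𝓝 0) := by
      have h2 : Tendsto (fun k => t * (Real.exp (η k * t) - 1) + ‖q k‖) atTop
          (𝓝 (t * (Real.exp (0 * t) - 1) + 0)) :=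
        (((Real.continuous_exp.tendsto _).comp (hηlim.mul_const t)).sub_const 1
          |>.const_mul t).add hqlim
      simpa using h2
    have h3 : Tendsto (fun k => a k * (G k ^ m k - 1) - t * (q k / ‖q k‖)) atTop (𝓝 0) :=
      squeeze_zero_norm (fun k => norm_mul_pow_sub_one_sub_le (hη0 k).le (haq k) (hq _ (hη0 k))
        (hq2 _ (hη0 k)) ht) h1
    simpa using h3.add (hulim.const_mul (t : ℂ))
  have hlim' : Tendsto (fun k => Q.proj (incl w (a k)) +
      Q.proj (incl w (a k * (G k ^ m k - 1)))) 𝒰 (𝓝 (y + Q.proj (incl w (t * u)))) :=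
    Tendsto.add hy (((Q.continuous_proj.comp (continuous_incl w)).tendsto _).comp
      (hlim.mono_left h𝒰))
  refine hA.mem_of_tendsto hlim' (Eventually.of_forall fun k => ?_)
  have := hinv (h (η k) * g (η k) ^ m k)
    (mul_mem (hS _ (hη0 k)) (pow_mem (gS _ (hη0 k)) _)) _ hz
  rw [mul_incl, coord_mixedEmbedding] at this
  rw [← map_add, ← map_add]
  convert! this using 3
  simp only [ha, hG]
  push_cast
  rw [map_mul, map_pow]
  ring

variable [T2Space Y]

/-- The image of a ray that is not orthogonal to any nonzero frequency is dense. -/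
theorem dense_ray {w : InfinitePlace K} {u : ℂ}
    (hu : ∀ ξ ∈ (Q.freq : Set (mixedSpace K)) \ {0}, (coord w ξ * u).re ≠ 0) :
    Dense {y | ∃ t : ℝ, 0 ≤ t ∧ Q.proj (incl w (t * u)) = y} := by
  set s := {y | ∃ t : ℝ, 0 ≤ t ∧ Q.proj (incl w (t * u)) = y}
  let N : AddSubmonoid Y :=
    { carrier := s
      zero_mem' := ⟨0, le_rfl, by simp⟩
      add_mem' := by
        rintro _ _ ⟨t, ht, rfl⟩ ⟨t', ht', rfl⟩
        exact ⟨t + t', add_nonneg ht ht', by push_cast; rw [add_mul, map_add, map_add]⟩ }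
  have hN : (AddSubmonoid.closure s : Set Y) = s := by
    rw [show s = (N : Set Y) from rfl, AddSubmonoid.closure_eq]
  have key : Dense (AddSubgroup.closure s : Set Y) := by
    refine dense_of_forall_character Q.character Q.continuous_character Q.separates _
      fun ξ hξ => ?_
    by_cases h0 : ξ.1 = 0
    · have : ξ = 0 := Subtype.ext h0
      rw [this, map_zero]
    exfalso
    have hre := hu ξ.1 ⟨ξ.2, h0⟩
    set c : ℝ := w.mult * (coord w ξ.1 * u).re with hc
    have hc0 : c ≠ 0 := mul_ne_zero (by exact_mod_cast w.mult_pos.ne') hre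
    have hpair : ∀ t : ℝ, pairing ξ.1 (incl w (t * u)) = t * c := fun t => by
      rw [pairing_incl, hc, show coord w ξ.1 * (t * u) = (t : ℂ) * (coord w ξ.1 * u) by ring,
        Complex.re_ofReal_mul]
      ring
    -- At this point of the ray the character takes the value 1/2 modulo 1.
    obtain ⟨t, ht, htc⟩ : ∃ t : ℝ, 0 ≤ t ∧ |t * c| = 1 / 2 :=
      ⟨1 / (2 * |c|), by positivity, by
        rw [abs_mul, abs_of_nonneg (by positivity)]
        field_simp [abs_ne_zero.2 hc0]⟩
    have := hξ _ (AddSubgroup.subset_closure ⟨t, ht, rfl⟩)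
    rw [Q.character_proj, hpair, AddCircle.coe_eq_zero_iff] at this
    obtain ⟨n, hn⟩ := this
    rw [zsmul_eq_mul, mul_one] at hn
    rw [← hn] at htc
    have h2 : |2 * n| = 1 := by
      have : ((|2 * n| : ℤ) : ℝ) = 1 := by
        push_cast
        rw [abs_mul, htc]
        norm_num
      exact_mod_cast this
    rcases (abs_eq one_pos.le).1 h2 with h | h <;> omega
  rw [← hN]
  -- In a compact group a submonoid is dense as soon as the group it generates is, so half of the
  -- line suffices.
  exact dense_addSubmonoidClosure_iff_addSubgroupClosure.2 key

/-- A closed set that is invariant under a subgroup of finite index of the units and accumulates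
at `0` is everything. -/
theorem eq_univ_of_accPt_zero (hcard : 3 ≤ Fintype.card (InfinitePlace K)) (hCM : ¬ IsCMField K)
    {S : Subgroup (𝓞 K)ˣ} (hS : S.FiniteIndex) {A : Set Y} (hA : IsClosed A)
    (hinv : ∀ u ∈ S, ∀ x, Q.proj x ∈ A → Q.proj (mixedEmbedding K (u : K) * x) ∈ A)
    (hacc : AccPt 0 (𝓟 A)) : A = Set.univ := by
  have : Nontrivial (InfinitePlace K) := Fintype.one_lt_card_iff_nontrivial.1 (by omega)
  obtain ⟨w, z, hz, hzim, hzA⟩ := Q.exists_incl_mem hS hA hinv hacc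
  obtain ⟨u, hu, hu'⟩ := exists_isTangentDirection_re_ne_zero hcard hCM hS w hz hzim
    (Q.countable_freq.mono Set.sdiff_subset) (D := (Q.freq : Set (mixedSpace K)) \ {0})
    (fun ξ hξ => Q.coord_ne_zero hξ.1 hξ.2 w)
  obtain ⟨y, hy⟩ := Q.exists_ray_subset hA hinv hzA hu
  have hsub : (Set.univ : Set Y) ⊆ (fun b => y + b) ⁻¹' A := by
    rw [← (Q.dense_ray hu').closure_eq]
    refine closure_minimal ?_ (hA.preimage (by fun_prop))
    rintro _ ⟨t, ht, rfl⟩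
    exact hy t ht
  refine Set.eq_univ_of_forall fun c => ?_
  simpa using hsub (Set.mem_univ (c - y))

end QuotientPresentation

/-! ### The pairing as a trace form -/

section Pairing

variable {K : Type*} [Field K] [NumberField K]

theorem pairing_eq_sum (ξ x : mixedSpace K) :
    pairing ξ x = ∑ w : InfinitePlace K, w.mult * (coord w ξ * coord w x).re := by
  classical
  rw [InfinitePlace.sum_eq_sum_add_sum]
  change ∑ w, ξ.1 w * x.1 w + ∑ w, 2 * (ξ.2 w * x.2 w).re = _
  congr 1
  · exact Finset.sum_congr rfl fun w _ => by
      simp [coord_of_isReal w.2, InfinitePlace.mult, w.2]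
  · exact Finset.sum_congr rfl fun w _ => by
      simp only [coord_of_isComplex w.2, InfinitePlace.mult,
        InfinitePlace.not_isReal_iff_isComplex.2 w.2, if_false]
      norm_num

theorem pairing_comm (ξ x : mixedSpace K) : pairing ξ x = pairing x ξ := by
  simp only [pairing_eq_sum, mul_comm (coord _ ξ)]

theorem pairing_mul_left (a ξ x : mixedSpace K) : pairing (a * ξ) x = pairing ξ (a * x) := by
  simp only [pairing_eq_sum, coord_mul]
  exact Finset.sum_congr rfl fun w _ => by ring_nf

theorem pairing_add_left (ξ ξ' x : mixedSpace K) :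
    pairing (ξ + ξ') x = pairing ξ x + pairing ξ' x := by
  rw [pairing_comm, map_add, pairing_comm x, pairing_comm x]

/-- The pairing as a linear map to the dual space. -/
noncomputable def pairingToDual : mixedSpace K →ₗ[ℝ] Module.Dual ℝ (mixedSpace K) where
  toFun ξ := (pairing ξ).toRealLinearMap (continuous_pairing ξ)
  map_add' ξ ξ' := LinearMap.ext fun x => pairing_add_left ξ ξ' x
  map_smul' c ξ := LinearMap.ext fun x => by
    change pairing (c • ξ) x = c • pairing ξ x
    rw [pairing_comm, pairing_comm ξ]
    exact ((pairing x).toRealLinearMap (continuous_pairing x)).map_smul c ξ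

theorem pairingToDual_apply (ξ x : mixedSpace K) : pairingToDual ξ x = pairing ξ x := rfl

theorem eq_zero_of_pairing_eq_zero {ξ : mixedSpace K} (h : ∀ x, pairing ξ x = 0) : ξ = 0 := by
  refine forall_normAtPlace_eq_zero_iff.1 fun w => ?_
  have := h (incl w (star (coord w ξ)))
  rw [pairing_incl, mul_eq_zero, or_iff_right (by exact_mod_cast w.mult_pos.ne')] at this
  rw [← norm_coord, norm_eq_zero]
  rw [Complex.star_def, Complex.mul_conj, Complex.ofReal_re, Complex.normSq_eq_zero] at this
  exact this

theorem pairingToDual_surjective :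
    Function.Surjective (pairingToDual : mixedSpace K →ₗ[ℝ] Module.Dual ℝ (mixedSpace K)) := by
  classical
  refine (LinearMap.injective_iff_surjective_of_finrank_eq_finrank
    Subspace.dual_finrank_eq.symm).1 ?_
  rw [injective_iff_map_eq_zero]
  exact fun ξ hξ => eq_zero_of_pairing_eq_zero fun x => LinearMap.congr_fun hξ x

theorem exists_pairing_eq {ι : Type*} (b : Module.Basis ι ℝ (mixedSpace K)) (c : ι → ℝ) :
    ∃ ξ, ∀ i, pairing ξ (b i) = c i := by
  obtain ⟨ξ, hξ⟩ := pairingToDual_surjective (b.constr ℝ c)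
  exact ⟨ξ, fun i => by rw [← pairingToDual_apply, hξ, Module.Basis.constr_basis]⟩

theorem eq_of_pairing_basis_eq {ι : Type*} (b : Module.Basis ι ℝ (mixedSpace K))
    {ξ ξ' : mixedSpace K} (h : ∀ i, pairing ξ (b i) = pairing ξ' (b i)) : ξ = ξ' := by
  have h1 : pairingToDual ξ = pairingToDual ξ' := b.ext h
  rw [← sub_eq_zero]
  refine eq_zero_of_pairing_eq_zero fun x => ?_
  rw [← pairingToDual_apply, map_sub, h1, sub_self, LinearMap.zero_apply]

theorem eq_zero_of_pairing_int {ξ : mixedSpace K} (h : ∀ x, ∃ m : ℤ, pairing ξ x = m) : ξ = 0 := by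
  refine eq_zero_of_pairing_eq_zero fun x => ?_
  by_contra h0
  obtain ⟨m, hm⟩ := h ((1 / (2 * pairing ξ x)) • x)
  rw [← pairingToDual_apply, map_smul, pairingToDual_apply, smul_eq_mul] at hm
  field_simp at hm
  have : (1 : ℤ) = 2 * m := by exact_mod_cast hm
  omega

/-- Group the embeddings by place: the one or two over w have the same real part. The factor 2 at
complex places thus makes the pairing restrict to the trace form on K. -/
theorem sum_mult_mul_re_embedding (x : K) :
    ∑ w : InfinitePlace K, w.mult * (w.embedding x).re = Algebra.trace ℚ K x := by
  classical
  have htr : ((Algebra.trace ℚ K x : ℚ) : ℂ) = ∑ φ : K →+* ℂ, φ x := by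
    have := trace_eq_sum_embeddings ℂ (K := ℚ) (L := K) (x := x)
    rw [eq_ratCast] at this
    rw [this]
    exact Fintype.sum_equiv (RingHom.equivRatAlgHom (R := K) (S := ℂ)).symm _ _ fun _ => rfl
  have hre : ((Algebra.trace ℚ K x : ℚ) : ℝ) = ∑ φ : K →+* ℂ, (φ x).re := by
    rw [← Complex.re_sum, ← htr, Complex.ratCast_re]
  rw [hre, ← Finset.univ.sum_fiberwise fun φ : K →+* ℂ => InfinitePlace.mk φ]
  refine Finset.sum_congr rfl fun w _ => ?_
  rw [Finset.sum_congr rfl (g := fun _ => (w.embedding x).re), Finset.sum_const,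
    InfinitePlace.card_filter_mk_eq, nsmul_eq_mul]
  intro φ hφ
  have hφ : InfinitePlace.mk φ = w := (Finset.mem_filter.1 hφ).2
  rw [← InfinitePlace.mk_embedding w, InfinitePlace.mk_eq_iff] at hφ
  rcases hφ with h | h
  · rw [h]
  · rw [← h, ComplexEmbedding.conjugate_coe_eq, Complex.conj_re]

theorem pairing_mixedEmbedding (a b : K) :
    pairing (mixedEmbedding K a) (mixedEmbedding K b) = Algebra.trace ℚ K (a * b) := by
  rw [← sum_mult_mul_re_embedding, pairing_eq_sum]
  simp only [coord_mixedEmbedding, map_mul]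

/-- A vector that pairs rationally with the integers of `K` comes from `K`. -/
theorem exists_mixedEmbedding_eq {ξ : mixedSpace K}
    (h : ∀ x : 𝓞 K, ∃ q : ℚ, pairing ξ (mixedEmbedding K x) = q) :
    ∃ a : K, mixedEmbedding K a = ξ := by
  classical
  choose q hq using fun i => h (RingOfIntegers.basis K i)
  let d := (integralBasis K).traceDual
  -- The element of K with prescribed traces against an integral basis is read off in the trace-dual
  -- basis.
  refine ⟨∑ i, q i • d i, eq_of_pairing_basis_eq (latticeBasis K) fun j => ?_⟩
  have h1 : Algebra.trace ℚ K ((∑ i, q i • d i) * integralBasis K j) = q j := by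
    rw [Finset.sum_mul, map_sum, Finset.sum_eq_single j]
    · rw [smul_mul_assoc, map_smul, Module.Basis.trace_traceDual_mul, if_pos rfl, smul_eq_mul,
        mul_one]
    · intro i _ hij
      rw [smul_mul_assoc, map_smul, Module.Basis.trace_traceDual_mul, if_neg hij.symm, smul_zero]
    · simp
  rw [latticeBasis_apply, pairing_mixedEmbedding, h1, integralBasis_apply, hq]

/-- The witness makes the product 1/(2d), whose trace is 1/2. -/
theorem exists_trace_mul_ne_int {b : K} (hb : b ≠ 0) :
    ∃ a : K, ∀ m : ℤ, pairing (mixedEmbedding K b) (mixedEmbedding K a) ≠ m := by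
  refine ⟨b⁻¹ * algebraMap ℚ K (1 / (2 * Module.finrank ℚ K)), fun m hm => ?_⟩
  have hd : (Module.finrank ℚ K : ℚ) ≠ 0 := by exact_mod_cast Module.finrank_pos.ne'
  rw [pairing_mixedEmbedding, mul_inv_cancel_left₀ hb, Algebra.trace_algebraMap] at hm
  have h2 : (Module.finrank ℚ K • (1 / (2 * Module.finrank ℚ K)) : ℚ) = 1 / 2 := by
    rw [nsmul_eq_mul]
    field_simp
  rw [h2] at hm
  have h3 : (1 : ℝ) = 2 * m := by
    rw [← hm]; norm_num
  have : (1 : ℤ) = 2 * m := by exact_mod_cast h3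
  omega

end Pairing

/-! ### Quotients by annihilators -/

section Annihilator

variable {K : Type*} [Field K] [NumberField K]

/-- The subgroup of vectors that pair integrally with a subgroup. -/
def annihilator (D : AddSubgroup (mixedSpace K)) : AddSubgroup (mixedSpace K) where
  carrier := {x | ∀ ξ ∈ D, ∃ m : ℤ, pairing ξ x = m}
  zero_mem' ξ _ := ⟨0, by simp⟩
  add_mem' {x y} hx hy ξ hξ := by
    obtain ⟨m, hm⟩ := hx ξ hξ
    obtain ⟨n, hn⟩ := hy ξ hξ
    exact ⟨m + n, by rw [map_add, hm, hn]; push_cast; rfl⟩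
  neg_mem' {x} hx ξ hξ := by
    obtain ⟨m, hm⟩ := hx ξ hξ
    exact ⟨-m, by rw [map_neg, hm]; push_cast; rfl⟩

theorem coe_unitAddCircle_eq_zero_iff (x : ℝ) :
    ((x : ℝ) : UnitAddCircle) = 0 ↔ ∃ m : ℤ, x = m := by
  rw [AddCircle.coe_eq_zero_iff]
  simp [eq_comm]

theorem isClosed_annihilator (D : AddSubgroup (mixedSpace K)) :
    IsClosed (annihilator D : Set (mixedSpace K)) := by
  have : (annihilator D : Set (mixedSpace K)) =
      ⋂ ξ ∈ D, {x | ((pairing ξ x : ℝ) : UnitAddCircle) = 0} := by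
    ext x
    simp only [Set.mem_iInter, Set.mem_ofPred_eq, coe_unitAddCircle_eq_zero_iff]
    exact Iff.rfl
  rw [this]
  exact isClosed_biInter fun ξ _ => isClosed_singleton.preimage
    ((AddCircle.continuous_mk' 1).comp (continuous_pairing ξ))

/-- The characters of a quotient by a lattice in the annihilator of `D`. -/
noncomputable def quotientCharacter (Λ D : AddSubgroup (mixedSpace K)) (h : Λ ≤ annihilator D) :
    D →+ (mixedSpace K ⧸ Λ) →+ UnitAddCircle where
  toFun ξ := QuotientAddGroup.lift Λ
    ((QuotientAddGroup.mk' (AddSubgroup.zmultiples (1 : ℝ))).comp (pairing ξ.1))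
    fun x hx => (coe_unitAddCircle_eq_zero_iff _).2 (h hx ξ.1 ξ.2)
  map_zero' := by
    refine QuotientAddGroup.addMonoidHom_ext _ (AddMonoidHom.ext fun x => ?_)
    change ((pairing 0 x : ℝ) : UnitAddCircle) = 0
    rw [pairing_comm, map_zero, AddCircle.coe_zero]
  map_add' ξ ξ' := by
    refine QuotientAddGroup.addMonoidHom_ext _ (AddMonoidHom.ext fun x => ?_)
    change ((pairing (ξ.1 + ξ'.1) x : ℝ) : UnitAddCircle) =
      ((pairing ξ.1 x : ℝ) : UnitAddCircle) + ((pairing ξ'.1 x : ℝ) : UnitAddCircle)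
    rw [pairing_add_left, AddCircle.coe_add]

/-- The quotient of `ℝ^{r₁} ⊕ ℂ^{r₂}` by an annihilator, with its characters. -/
noncomputable def annihilatorPresentation (D : AddSubgroup (mixedSpace K))
    (hD : ∀ ξ ∈ D, ∃ a : K, mixedEmbedding K a = ξ) :
    QuotientPresentation K (mixedSpace K ⧸ annihilator D) where
  proj := QuotientAddGroup.mk' _
  continuous_proj := continuous_quotient_mk'
  surjective_proj := QuotientAddGroup.mk'_surjective _
  isOpenMap_proj := QuotientAddGroup.isOpenMap_coe
  freq := D
  freq_le := hD
  character := quotientCharacter _ D le_rfl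
  character_proj _ _ := rfl
  separates y hy := by
    obtain ⟨x, rfl⟩ := QuotientAddGroup.mk_surjective y
    by_contra! hall
    refine hy ((QuotientAddGroup.eq_zero_iff x).2 fun ξ hξ => ?_)
    exact (coe_unitAddCircle_eq_zero_iff _).1 (hall ⟨ξ, hξ⟩)

end Annihilator

/-! ### Rigidity of closed invariant sets and finiteness of orbits -/

namespace QuotientPresentation

variable {K : Type*} [Field K] [NumberField K] {Y : Type*} [AddCommGroup Y] [TopologicalSpace Y]
  (Q : QuotientPresentation K Y) {H : Type*} [Group H] [DistribMulAction H Y] {φ : H →* (𝓞 K)ˣ}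

/-- Elements of `K` project to points with a stabilizer of finite index. -/
theorem finiteIndex_stabilizer_mixedEmbedding
    (hact : ∀ h x, h • Q.proj x = Q.proj (mixedEmbedding K (φ h : K) * x))
    {N : ℕ} (hN : N ≠ 0)
    (hNQ : ∀ x : 𝓞 K, Q.proj (mixedEmbedding K (N * x : K)) = 0) (a : K) :
    (MulAction.stabilizer H (Q.proj (mixedEmbedding K a))).FiniteIndex := by
  obtain ⟨b, c, hc, rfl⟩ := IsFractionRing.div_surjective (A := 𝓞 K) a
  have hc0 : c ≠ 0 := nonZeroDivisors.ne_zero hc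
  set I : Ideal (𝓞 K) := Ideal.span {(N : 𝓞 K) * c}
  have hI : I ≠ ⊥ := by
    rw [Ne, Ideal.span_singleton_eq_bot]
    exact mul_ne_zero (Nat.cast_ne_zero.2 hN) hc0
  have : Finite (𝓞 K ⧸ I) := Ideal.finiteQuotientOfFreeOfNeBot I hI
  -- A unit congruent to 1 modulo Nc moves b/c by an element of N 𝓞_K, which projects to 0.
  let f : H →* (𝓞 K ⧸ I)ˣ := (Units.map (Ideal.Quotient.mk I).toMonoidHom).comp φ
  have hf : f.ker.FiniteIndex := Subgroup.finiteIndex_ker f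
  refine Subgroup.finiteIndex_of_le (H := f.ker) fun h hh => ?_
  have h1 : Ideal.Quotient.mk I (φ h : 𝓞 K) = Ideal.Quotient.mk I 1 := by
    rw [map_one]
    exact congrArg Units.val (MonoidHom.mem_ker.1 hh)
  obtain ⟨d, hd⟩ := Ideal.mem_span_singleton'.1 (Ideal.Quotient.eq.1 h1)
  have hcK : algebraMap (𝓞 K) K c ≠ 0 := by
    rwa [Ne, FaithfulSMul.algebraMap_eq_zero_iff]
  have hu : (φ h : K) * (algebraMap (𝓞 K) K b / algebraMap (𝓞 K) K c) =
      algebraMap (𝓞 K) K b / algebraMap (𝓞 K) K c +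
        N * algebraMap (𝓞 K) K (d * b) := by
    have h2 : (φ h : K) = 1 + algebraMap (𝓞 K) K d * (N * algebraMap (𝓞 K) K c) := by
      have := congrArg (algebraMap (𝓞 K) K) hd
      simp only [map_mul, map_sub, map_natCast, map_one] at this
      rw [this]
      ring
    rw [h2, map_mul]
    field_simp
  rw [MulAction.mem_stabilizer_iff, hact, ← map_mul, hu, map_add, map_add]
  exact (congrArg _ (hNQ (d * b))).trans (add_zero _)

variable [IsTopologicalAddGroup Y] [CompactSpace Y] [T2Space Y]

/-- A character with frequency b that vanishes on the image of K has integral trace form Tr(ba) for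
all a in K, so b = 0. This supplies the dense periodic points. -/
theorem dense_range_mixedEmbedding :
    Dense (Set.range fun a : K => Q.proj (mixedEmbedding K a)) := by
  let P : AddSubgroup Y := (Q.proj.comp (mixedEmbedding K).toAddMonoidHom).range
  refine dense_of_forall_character Q.character Q.continuous_character Q.separates P fun ξ hξ => ?_
  obtain ⟨b, hb⟩ := Q.freq_le ξ.1 ξ.2
  by_cases hb0 : b = 0
  · have : ξ = 0 := Subtype.ext (by rw [← hb, hb0, map_zero]; rfl)
    rw [this, map_zero]
  · exfalso
    obtain ⟨a, ha⟩ := exists_trace_mul_ne_int hb0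
    have := hξ _ ⟨a, rfl⟩
    rw [AddMonoidHom.comp_apply, Q.character_proj, coe_unitAddCircle_eq_zero_iff, ← hb] at this
    obtain ⟨m, hm⟩ := this
    exact ha m hm

variable [ContinuousConstSMul H Y]

/-- An infinite closed invariant set is everything. -/
theorem eq_univ_of_infinite
    (hact : ∀ h x, h • Q.proj x = Q.proj (mixedEmbedding K (φ h : K) * x))
    (hφ : φ.range.FiniteIndex)
    (hcard : 3 ≤ Fintype.card (InfinitePlace K)) (hCM : ¬ IsCMField K) {N : ℕ} (hN : N ≠ 0)
    (hNQ : ∀ x : 𝓞 K, Q.proj (mixedEmbedding K (N * x : K)) = 0) {A : Set Y} (hA : IsClosed A)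
    (hinv : ∀ h : H, ∀ a ∈ A, h • a ∈ A) (hinf : A.Infinite) : A = Set.univ := by
  refine eq_univ_of_infinite_of_invariant (H := H) ?_ ?_ hA hinv hinf
  · intro S hS B hB hBinv hacc
    have hfin : (S.map φ).FiniteIndex := ⟨by
      rw [Subgroup.index_map]
      refine mul_ne_zero (fun h0 => hS.index_ne_zero ?_) hφ.index_ne_zero
      exact Nat.eq_zero_of_zero_dvd (h0 ▸ Subgroup.index_dvd_of_le le_sup_left)⟩
    refine Q.eq_univ_of_accPt_zero hcard hCM hfin hB ?_ hacc
    rintro _ ⟨s, hs, rfl⟩ x hx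
    rw [← hact]
    exact hBinv s hs _ hx
  · refine Q.dense_range_mixedEmbedding.mono ?_
    rintro _ ⟨a, rfl⟩
    exact Q.finiteIndex_stabilizer_mixedEmbedding hact hN hNQ a

/-- Only finitely many orbits are disjoint from a given nonempty open set. -/
theorem finite_orbits_disjoint
    (hact : ∀ h x, h • Q.proj x = Q.proj (mixedEmbedding K (φ h : K) * x))
    (hφ : φ.range.FiniteIndex)
    (hcard : 3 ≤ Fintype.card (InfinitePlace K)) (hCM : ¬ IsCMField K) {N : ℕ} (hN : N ≠ 0)
    (hNQ : ∀ x : 𝓞 K, Q.proj (mixedEmbedding K (N * x : K)) = 0) {U : Set Y} (hU : IsOpen U)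
    (hne : U.Nonempty) : {O : Set Y | ∃ y, O = MulAction.orbit H y ∧ Disjoint O U}.Finite := by
  set 𝓞s := {O : Set Y | ∃ y, O = MulAction.orbit H y ∧ Disjoint O U}
  have hdisj : Disjoint (closure (⋃₀ 𝓞s)) U := by
    refine Disjoint.closure_left ?_ hU
    rw [Set.disjoint_sUnion_left]
    rintro O ⟨y, -, hO⟩
    exact hO
  have hinv0 : ∀ h : H, ∀ a ∈ ⋃₀ 𝓞s, h • a ∈ ⋃₀ 𝓞s := by
    rintro h a ⟨O, ⟨y, rfl, hO⟩, ha⟩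
    exact ⟨_, ⟨y, rfl, hO⟩, MulAction.mem_orbit_of_mem_orbit h ha⟩
  -- The closed invariant hull of all these orbits still misses U, so rigidity makes it finite; a
  -- finite set has finitely many subsets.
  have hfin : (closure (⋃₀ 𝓞s)).Finite := by
    by_contra hinf
    have huniv := Q.eq_univ_of_infinite hact hφ hcard hCM hN hNQ isClosed_closure (fun h a ha =>
      map_mem_closure (continuous_const_smul h) ha (hinv0 h)) hinf
    obtain ⟨u, hu⟩ := hne
    exact Set.disjoint_left.1 hdisj (huniv.ge (Set.mem_univ u)) hu
  exact hfin.finite_subsets.subset fun O hO =>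
    (Set.subset_sUnion_of_mem hO).trans subset_closure

/-- Only finitely many orbits miss a translate of a given neighbourhood of `0`. -/
theorem finite_orbits_missing_translate
    (hact : ∀ h x, h • Q.proj x = Q.proj (mixedEmbedding K (φ h : K) * x))
    (hφ : φ.range.FiniteIndex)
    (hcard : 3 ≤ Fintype.card (InfinitePlace K)) (hCM : ¬ IsCMField K) {N : ℕ} (hN : N ≠ 0)
    (hNQ : ∀ x : 𝓞 K, Q.proj (mixedEmbedding K (N * x : K)) = 0) {W : Set Y}
    (hW : W ∈ 𝓝 (0 : Y)) :
    {O : Set Y | ∃ y, O = MulAction.orbit H y ∧ ∃ c, ∀ v ∈ W, c + v ∉ O}.Finite := by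
  have hsub : (fun p : Y × Y => p.1 - p.2) ⁻¹' W ∈ 𝓝 (0 : Y × Y) :=
    (by fun_prop : Continuous fun p : Y × Y => p.1 - p.2).continuousAt.preimage_mem_nhds
      (by simpa using hW)
  -- With V - V ⊆ W, an orbit missing c + W misses e + V whenever c ∈ e + V. Finitely many e cover
  -- Y, so the varying centre c is replaced by finitely many open sets.
  obtain ⟨V, ⟨hV0, hV⟩, hVW⟩ := ((nhds_basis_opens (0 : Y)).prod_self).mem_iff.1
    (show _ ∈ 𝓝 (0 : Y) ×ˢ 𝓝 (0 : Y) by rw [← nhds_prod_eq]; exact hsub)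
  obtain ⟨E, hcov⟩ := isCompact_univ.elim_finite_subcover (fun e : Y => (fun y => y - e) ⁻¹' V)
    (fun e => hV.preimage (by fun_prop)) (fun y _ => Set.mem_iUnion.2 ⟨y, by simpa using hV0⟩)
  refine (Set.Finite.biUnion E.finite_toSet fun e _ =>
    Q.finite_orbits_disjoint hact hφ hcard hCM hN hNQ (U := (fun y => y - e) ⁻¹' V)
      (hV.preimage (by fun_prop)) ⟨e, by simpa using hV0⟩).subset ?_
  rintro O ⟨y, hO, c, hc⟩
  obtain ⟨e, he, hce⟩ := Set.mem_iUnion₂.1 (hcov (Set.mem_univ c))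
  refine Set.mem_biUnion he ⟨y, hO, Set.disjoint_right.2 fun o ho hoO => ?_⟩
  refine hc (o - c) ?_ (by simpa using hoO)
  have := hVW (Set.mk_mem_prod ho hce)
  simpa using this

end QuotientPresentation

/-! ### Units acting on a quotient -/

section QuotientAction

theorem continuous_quotientMap {K : Type*} [Field K] {Λ Λ' : AddSubgroup (mixedSpace K)}
    (a : mixedSpace K)
    (h : Λ ≤ Λ'.comap (AddMonoidHom.mulLeft a)) :
    Continuous (QuotientAddGroup.map Λ Λ' (AddMonoidHom.mulLeft a) h) := by
  refine continuous_quot_lift _ ?_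
  exact continuous_quotient_mk'.comp (continuous_const.mul continuous_id)

variable {K : Type*} [Field K] [NumberField K] {H : Type*} [Group H]

/-- The action on a quotient through a homomorphism to the group of units. -/
@[reducible]
noncomputable def quotientAction (φ : H →* (𝓞 K)ˣ) (Λ : AddSubgroup (mixedSpace K))
    (hΛ : ∀ h, ∀ x ∈ Λ, mixedEmbedding K (φ h : K) * x ∈ Λ) :
    DistribMulAction H (mixedSpace K ⧸ Λ) where
  smul h := QuotientAddGroup.map Λ Λ (AddMonoidHom.mulLeft (mixedEmbedding K (φ h : K))) (hΛ h)
  one_smul y := by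
    obtain ⟨x, rfl⟩ := QuotientAddGroup.mk_surjective y
    change ((mixedEmbedding K (φ 1 : K) * x : mixedSpace K) : mixedSpace K ⧸ Λ) = x
    simp
  mul_smul h h' y := by
    obtain ⟨x, rfl⟩ := QuotientAddGroup.mk_surjective y
    change ((mixedEmbedding K (φ (h * h') : K) * x : mixedSpace K) : mixedSpace K ⧸ Λ) =
      (mixedEmbedding K (φ h : K) * (mixedEmbedding K (φ h' : K) * x) : mixedSpace K)
    rw [map_mul, Units.coe_mul, map_mul, mul_assoc]
  smul_zero h := map_zero _
  smul_add h := map_add _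

end QuotientAction

theorem continuous_euclNorm {K : Type*} [Field K] [NumberField K] :
    Continuous (euclNorm : mixedSpace K × mixedSpace K → ℝ) := by
  classical
  unfold euclNorm
  fun_prop

/-! ### Slopes as points of the projective line -/

section Slopes

variable {K : Type*} [Field K]

/-- Homogeneous coordinates of a slope: `dualSlope κ` consists of the pairs `(α ξ, β ξ)`. -/
def slopeCoeff : OnePoint K → K × K
  | OnePoint.some κ => (-κ, 1)
  | OnePoint.infty => (1, 0)

/-- Provides the linear section x ↦ (sx, tx) of (x, y) ↦ αx + βy. -/
theorem exists_slopeCoeff_combination (κ : OnePoint K) :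
    ∃ s t : K, (slopeCoeff κ).1 * s + (slopeCoeff κ).2 * t = 1 := by
  rcases κ with _ | κ
  · exact ⟨1, 0, by simp [slopeCoeff]⟩
  · exact ⟨0, 1, by simp [slopeCoeff]⟩

theorem slope_eq_of_mul_eq_mul {κ κ' : OnePoint K} {ξ₁ ξ₂ : mixedSpace K}
    (h : mixedEmbedding K (slopeCoeff κ).2 * ξ₁ = mixedEmbedding K (slopeCoeff κ).1 * ξ₂)
    (h' : mixedEmbedding K (slopeCoeff κ').2 * ξ₁ = mixedEmbedding K (slopeCoeff κ').1 * ξ₂)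
    (hne : ¬ (ξ₁ = 0 ∧ ξ₂ = 0)) : κ = κ' := by
  rcases κ with _ | κ <;> rcases κ' with _ | κ'
  · rfl
  · exfalso
    change mixedEmbedding K 0 * ξ₁ = mixedEmbedding K 1 * ξ₂ at h
    change mixedEmbedding K 1 * ξ₁ = mixedEmbedding K (-κ') * ξ₂ at h'
    simp only [map_zero, zero_mul, map_one, one_mul] at h h'
    exact hne ⟨by rw [h', ← h, mul_zero], h.symm⟩
  · exfalso
    change mixedEmbedding K 0 * ξ₁ = mixedEmbedding K 1 * ξ₂ at h'
    change mixedEmbedding K 1 * ξ₁ = mixedEmbedding K (-κ) * ξ₂ at h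
    simp only [map_zero, zero_mul, map_one, one_mul] at h h'
    exact hne ⟨by rw [h, ← h', mul_zero], h'.symm⟩
  · change mixedEmbedding K 1 * ξ₁ = mixedEmbedding K (-κ) * ξ₂ at h
    change mixedEmbedding K 1 * ξ₁ = mixedEmbedding K (-κ') * ξ₂ at h'
    by_contra hκ
    have hκ' : κ - κ' ≠ 0 := fun h0 => hκ (congrArg OnePoint.some (sub_eq_zero.1 h0))
    have h0 : mixedEmbedding K (κ - κ') * ξ₂ = 0 := by
      have := h.symm.trans h'
      rw [map_neg, map_neg, neg_mul, neg_mul, neg_inj] at this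
      rw [map_sub, sub_mul, this, sub_self]
    have h2 : ξ₂ = 0 := by
      calc ξ₂ = mixedEmbedding K ((κ - κ')⁻¹ * (κ - κ')) * ξ₂ := by
            rw [inv_mul_cancel₀ hκ', map_one, one_mul]
        _ = 0 := by rw [map_mul, mul_assoc, h0, mul_zero]
    rw [h2, mul_zero, map_one, one_mul] at h
    exact hne ⟨h, h2⟩

end Slopes

/-! ### Duality for Γ and the subtori T^κ -/

namespace Model

variable {K : Type*} [Field K] [NumberField K] {r : ℕ} (M : Model K r)

theorem mem_dual_iff {ξ : mixedSpace K} : ξ ∈ M.dual ↔ ξ ∈ annihilator M.Γ :=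
  forall₂_congr fun γ _ => by rw [pairing_comm]

/-- N is the index of Γ ∩ σ(𝓞_K) in σ(𝓞_K), finite by commensurability. -/
theorem exists_nat_mul_mem :
    ∃ N : ℕ, N ≠ 0 ∧ ∀ x : 𝓞 K, mixedEmbedding K (N * x : K) ∈ M.Γ := by
  refine ⟨_, M.Γ_commensurable.1, fun x => ?_⟩
  have := AddSubgroup.nsmul_index_mem (M.Γ.addSubgroupOf
    ((mixedEmbedding K).comp (algebraMap (𝓞 K) K)).toAddMonoidHom.range)
    ⟨mixedEmbedding K x, x, rfl⟩
  rw [AddSubgroup.mem_addSubgroupOf] at this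
  rw [map_mul, map_natCast, ← nsmul_eq_mul]
  exact this

theorem exists_mixedEmbedding_eq_of_mem_dual {ξ : mixedSpace K} (hξ : ξ ∈ annihilator M.Γ) :
    ∃ a : K, mixedEmbedding K a = ξ := by
  obtain ⟨N, hN, hNΓ⟩ := M.exists_nat_mul_mem
  refine exists_mixedEmbedding_eq fun x => ?_
  obtain ⟨m, hm⟩ := hξ _ (hNΓ x)
  rw [pairing_comm, map_mul, map_natCast, ← nsmul_eq_mul, map_nsmul, nsmul_eq_mul] at hm
  refine ⟨m / N, ?_⟩
  push_cast
  rw [eq_div_iff (by exact_mod_cast hN), ← hm, mul_comm]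

theorem le_annihilator_annihilator : M.Γ ≤ annihilator (annihilator M.Γ) := fun γ hγ ξ hξ => by
  rw [pairing_comm]
  exact hξ γ hγ

/-- A lattice is the annihilator of its dual. -/
theorem annihilator_annihilator_le : annihilator (annihilator M.Γ) ≤ M.Γ := by
  classical
  intro x hx
  let L : Submodule ℤ (mixedSpace K) := AddSubgroup.toIntSubmodule M.Γ
  have : DiscreteTopology L := M.Γ_discrete
  have : IsZLattice ℝ L := ⟨by
    obtain ⟨N, hN, hNΓ⟩ := M.exists_nat_mul_mem
    rw [eq_top_iff, ← (latticeBasis K).span_eq, Submodule.span_le]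
    rintro _ ⟨i, rfl⟩
    have h1 : (N : ℝ) • latticeBasis K i ∈ Submodule.span ℝ (L : Set (mixedSpace K)) := by
      refine Submodule.subset_span ?_
      have := hNΓ (RingOfIntegers.basis K i)
      rw [map_mul, map_natCast, ← nsmul_eq_mul] at this
      rw [Nat.cast_smul_eq_nsmul, latticeBasis_apply, integralBasis_apply]
      exact this
    have h2 := Submodule.smul_mem _ ((N : ℝ)⁻¹) h1
    rwa [inv_smul_smul₀ (by exact_mod_cast hN)] at h2⟩
  have : Module.Finite ℤ L := ZLattice.module_finite ℝ L
  have : Module.Free ℤ L := ZLattice.module_free ℝ L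
  let b := Module.Free.chooseBasis ℤ L
  have hint : ∀ i, ∃ m : ℤ, (b.ofZLatticeBasis ℝ L).repr x i = m := by
    intro i
    -- The dual basis vector ξ pairs integrally with Γ, so its pairing with x, the i-th coordinate
    -- of x, is an integer.
    obtain ⟨ξ, hξ⟩ := exists_pairing_eq (b.ofZLatticeBasis ℝ L) (Pi.single i 1)
    have hξ' : ∀ y, pairing ξ y = (b.ofZLatticeBasis ℝ L).repr y i := by
      intro y
      have : pairingToDual ξ = (b.ofZLatticeBasis ℝ L).coord i :=
        (b.ofZLatticeBasis ℝ L).ext fun j => by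
          rw [pairingToDual_apply, hξ, Module.Basis.coord_apply, Module.Basis.repr_self,
            Finsupp.single_apply, Pi.single_apply]
      rw [← pairingToDual_apply, this, Module.Basis.coord_apply]
    rw [← hξ']
    refine hx ξ fun γ hγ => ⟨b.repr ⟨γ, hγ⟩ i, ?_⟩
    rw [pairing_comm, hξ']
    exact b.ofZLatticeBasis_repr_apply ℝ L ⟨γ, hγ⟩ i
  have hxL : x ∈ L := by
    rw [← b.ofZLatticeBasis_span ℝ L, ← (b.ofZLatticeBasis ℝ L).sum_repr x]
    refine Submodule.sum_mem _ fun i _ => ?_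
    obtain ⟨m, hm⟩ := hint i
    rw [hm, Int.cast_smul_eq_zsmul]
    exact Submodule.smul_mem _ m (Submodule.subset_span ⟨i, rfl⟩)
  exact hxL

/-- The characters of `X²`. -/
noncomputable def pairCharacter :
    annihilator M.Γ × annihilator M.Γ →+ M.X × M.X →+ UnitAddCircle where
  toFun ξ := (quotientCharacter M.Γ _ M.le_annihilator_annihilator ξ.1).coprod
    (quotientCharacter M.Γ _ M.le_annihilator_annihilator ξ.2)
  map_zero' := by
    ext
    all_goals simp
  map_add' ξ ξ' := by
    refine AddMonoidHom.ext fun x => ?_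
    simp only [Prod.fst_add, Prod.snd_add, map_add, AddMonoidHom.coprod_apply,
      AddMonoidHom.add_apply]
    abel

theorem pairCharacter_proj (ξ : annihilator M.Γ × annihilator M.Γ)
    (v : mixedSpace K × mixedSpace K) : M.pairCharacter ξ (M.proj v) =
      ((pairing ξ.1.1 v.1 + pairing ξ.2.1 v.2 : ℝ) : UnitAddCircle) := rfl

theorem proj_surjective : Function.Surjective M.proj :=
  (QuotientAddGroup.mk'_surjective M.Γ).prodMap (QuotientAddGroup.mk'_surjective M.Γ)

theorem continuous_proj : Continuous M.proj :=
  (continuous_quotient_mk' : Continuous (QuotientAddGroup.mk' M.Γ)).prodMap continuous_quotient_mk'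

theorem isOpenMap_proj : IsOpenMap M.proj :=
  (QuotientAddGroup.isOpenMap_coe : IsOpenMap (QuotientAddGroup.mk' M.Γ)).prodMap
    QuotientAddGroup.isOpenMap_coe

theorem continuous_pairCharacter (ξ : annihilator M.Γ × annihilator M.Γ) :
    Continuous (M.pairCharacter ξ) := by
  rw [(M.isOpenMap_proj.isQuotientMap M.continuous_proj M.proj_surjective).continuous_iff]
  have : M.pairCharacter ξ ∘ M.proj =
      fun v => ((pairing ξ.1.1 v.1 + pairing ξ.2.1 v.2 : ℝ) : UnitAddCircle) :=
    funext fun v => M.pairCharacter_proj ξ v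
  rw [this]
  exact (AddCircle.continuous_mk' 1).comp (((continuous_pairing _).comp continuous_fst).add
    ((continuous_pairing _).comp continuous_snd))

theorem pairCharacter_separates {x : M.X × M.X} (hx : x ≠ 0) : ∃ ξ, M.pairCharacter ξ x ≠ 0 := by
  obtain ⟨v, rfl⟩ := M.proj_surjective x
  by_contra! hall
  refine hx (Prod.ext ?_ ?_)
  · refine (QuotientAddGroup.eq_zero_iff v.1).2 (M.annihilator_annihilator_le fun ξ hξ => ?_)
    have := hall (⟨ξ, hξ⟩, 0)
    rw [pairCharacter_proj, coe_unitAddCircle_eq_zero_iff] at this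
    simpa [pairing_comm 0] using this
  · refine (QuotientAddGroup.eq_zero_iff v.2).2 (M.annihilator_annihilator_le fun ξ hξ => ?_)
    have := hall (0, ⟨ξ, hξ⟩)
    rw [pairCharacter_proj, coe_unitAddCircle_eq_zero_iff] at this
    simpa [pairing_comm 0] using this

theorem norm_proj_le (v : mixedSpace K × mixedSpace K) : M.norm (M.proj v) ≤ euclNorm v :=
  csInf_le ⟨0, by
    rintro _ ⟨u, -, rfl⟩
    exact Real.sqrt_nonneg _⟩ ⟨v, rfl, rfl⟩

theorem euclNorm_lt_mem_nhds {ε : ℝ} (hε : 0 < ε) :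
    {v : mixedSpace K × mixedSpace K | euclNorm v < ε} ∈ 𝓝 0 :=
  (isOpen_lt continuous_euclNorm continuous_const).mem_nhds (by
    change euclNorm 0 < ε
    simpa [euclNorm] using hε)

theorem norm_lt_mem_nhds {ε : ℝ} (hε : 0 < ε) : {x : M.X × M.X | M.norm x < ε} ∈ 𝓝 0 := by
  have := M.isOpenMap_proj.image_mem_nhds (euclNorm_lt_mem_nhds (K := K) hε)
  rw [map_zero] at this
  refine mem_of_superset this ?_
  rintro _ ⟨v, hv, rfl⟩
  exact (M.norm_proj_le v).trans_lt hv

/-- The `ξ` such that `(α ξ, β ξ)` is in the dual group of `X²`, for a slope `(α, β)`. -/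
noncomputable def slopeFreq (κ : OnePoint K) : AddSubgroup (mixedSpace K) :=
  (annihilator M.Γ).comap (AddMonoidHom.mulLeft (mixedEmbedding K (slopeCoeff κ).1)) ⊓
    (annihilator M.Γ).comap (AddMonoidHom.mulLeft (mixedEmbedding K (slopeCoeff κ).2))

theorem slopeFreq_le (κ : OnePoint K) : M.slopeFreq κ ≤ annihilator M.Γ := by
  rintro ξ ⟨h1, h2⟩
  rcases κ with _ | κ
  · have : mixedEmbedding K 1 * ξ ∈ annihilator M.Γ := h1
    rwa [map_one, one_mul] at this
  · have : mixedEmbedding K 1 * ξ ∈ annihilator M.Γ := h2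
    rwa [map_one, one_mul] at this

theorem mem_dualSlope_iff (κ : OnePoint K) (ξ : M.dual × M.dual) :
    ξ ∈ M.dualSlope κ ↔ ∃ η ∈ M.slopeFreq κ, ξ.1.1 = mixedEmbedding K (slopeCoeff κ).1 * η ∧
      ξ.2.1 = mixedEmbedding K (slopeCoeff κ).2 * η := by
  have h1 := M.mem_dual_iff.1 ξ.1.2
  have h2 := M.mem_dual_iff.1 ξ.2.2
  constructor
  · intro h
    obtain ⟨η, he1, he2⟩ : ∃ η, ξ.1.1 = mixedEmbedding K (slopeCoeff κ).1 * η ∧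
        ξ.2.1 = mixedEmbedding K (slopeCoeff κ).2 * η := by
      rcases κ with _ | κ
      · have h : ξ.2.1 = 0 := h
        exact ⟨ξ.1.1, by change _ = mixedEmbedding K 1 * _; simp,
          by change _ = mixedEmbedding K 0 * _; simp [h]⟩
      · have h : ξ.1.1 + mixedEmbedding K κ * ξ.2.1 = 0 := h
        exact ⟨ξ.2.1, by
          change _ = mixedEmbedding K (-κ) * _
          rw [map_neg, neg_mul]
          exact eq_neg_of_add_eq_zero_left h, by change _ = mixedEmbedding K 1 * _; simp⟩
    rw [he1] at h1
    rw [he2] at h2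
    exact ⟨η, ⟨h1, h2⟩, he1, he2⟩
  · rintro ⟨η, -, he1, he2⟩
    rcases κ with _ | κ
    · change ξ.2.1 = 0
      rw [he2]
      change mixedEmbedding K 0 * _ = 0
      simp
    · change ξ.1.1 + mixedEmbedding K κ * ξ.2.1 = 0
      rw [he1, he2]
      change mixedEmbedding K (-κ) * η + mixedEmbedding K κ * (mixedEmbedding K 1 * η) = 0
      simp

/-- Multiplication is self-adjoint for the pairing, so the character (αη, βη) at v is the pairing of
η with αv₁ + βv₂. -/
theorem proj_mem_torus_iff (κ : OnePoint K) (v : mixedSpace K × mixedSpace K) :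
    M.proj v ∈ M.torus κ ↔ mixedEmbedding K (slopeCoeff κ).1 * v.1 +
      mixedEmbedding K (slopeCoeff κ).2 * v.2 ∈ annihilator (M.slopeFreq κ) := by
  have hchar : ∀ ξ : M.dual × M.dual, M.character ξ.1 (M.proj v).1 + M.character ξ.2 (M.proj v).2 =
      ((pairing ξ.1.1 v.1 + pairing ξ.2.1 v.2 : ℝ) : UnitAddCircle) := fun _ => rfl
  constructor
  · intro h η hη
    have := h (⟨_, M.mem_dual_iff.2 hη.1⟩, ⟨_, M.mem_dual_iff.2 hη.2⟩)
      ((M.mem_dualSlope_iff κ _).2 ⟨η, hη, rfl, rfl⟩)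
    rw [hchar, coe_unitAddCircle_eq_zero_iff] at this
    rw [map_add, ← pairing_mul_left, ← pairing_mul_left]
    exact this
  · intro h ξ hξ
    obtain ⟨η, hη, h1, h2⟩ := (M.mem_dualSlope_iff κ ξ).1 hξ
    rw [hchar, coe_unitAddCircle_eq_zero_iff, h1, h2, pairing_mul_left, pairing_mul_left,
      ← map_add]
    exact h η hη

theorem isClosed_torus (κ : OnePoint K) : IsClosed (M.torus κ : Set (M.X × M.X)) := by
  have hq := M.isOpenMap_proj.isQuotientMap M.continuous_proj M.proj_surjective
  rw [← hq.isClosed_preimage]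
  have : M.proj ⁻¹' (M.torus κ : Set (M.X × M.X)) =
      (fun v : mixedSpace K × mixedSpace K => mixedEmbedding K (slopeCoeff κ).1 * v.1 +
        mixedEmbedding K (slopeCoeff κ).2 * v.2) ⁻¹' annihilator (M.slopeFreq κ) :=
    Set.ext fun v => M.proj_mem_torus_iff κ v
  rw [this]
  exact (isClosed_annihilator _).preimage (by fun_prop)

/-- A character that is trivial on `T^κ` has slope `κ`. -/
theorem mul_eq_mul_of_trivial_on_torus {κ : OnePoint K} {ξ : annihilator M.Γ × annihilator M.Γ}
    (h : ∀ t ∈ M.torus κ, M.pairCharacter ξ t = 0) :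
    mixedEmbedding K (slopeCoeff κ).2 * ξ.1.1 = mixedEmbedding K (slopeCoeff κ).1 * ξ.2.1 := by
  rw [← sub_eq_zero]
  refine eq_zero_of_pairing_int fun x => ?_
  -- The vectors (βx, -αx) form a real subspace lying over T^κ. A linear form with only integral
  -- values on it is zero.
  have hmem : M.proj (mixedEmbedding K (slopeCoeff κ).2 * x,
      -(mixedEmbedding K (slopeCoeff κ).1 * x)) ∈ M.torus κ := by
    rw [proj_mem_torus_iff]
    convert! zero_mem (annihilator (M.slopeFreq κ)) using 1
    ring
  have := h _ hmem
  rw [pairCharacter_proj, coe_unitAddCircle_eq_zero_iff] at this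
  obtain ⟨m, hm⟩ := this
  refine ⟨m, ?_⟩
  rw [← hm, sub_eq_add_neg, pairing_add_left, pairing_mul_left, ← neg_mul, ← neg_mul,
    pairing_mul_left]

/-- Only finitely many of the subtori `T^κ` have a translate that is not `ε`-dense. -/
theorem finite_slopes {ε : ℝ} (hε : 0 < ε) :
    {κ : OnePoint K | ∃ y, ∀ t ∈ M.torus κ, ¬ M.norm (y + t) < ε}.Finite := by
  have : DiscreteTopology M.Γ := M.Γ_discrete
  have : CompactSpace M.X := M.Γ_cocompact
  have : IsClosed (M.Γ : Set (mixedSpace K)) := AddSubgroup.isClosed_of_discrete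
  obtain ⟨F, hF, hF'⟩ := exists_finset_forall_closed_addSubgroup M.pairCharacter
    M.continuous_pairCharacter (fun x hx => M.pairCharacter_separates hx) (M.norm_lt_mem_nhds hε)
  refine (Set.Finite.biUnion F.finite_toSet (t := fun ξ =>
    {κ : OnePoint K | ∀ t ∈ M.torus κ, M.pairCharacter ξ t = 0}) fun ξ hξ => ?_).subset ?_
  -- The slope of a nontrivial character is determined by the character, so it vanishes on at most
  -- one T^κ.
  · refine Set.Subsingleton.finite fun κ hκ κ' hκ' => ?_
    refine slope_eq_of_mul_eq_mul (M.mul_eq_mul_of_trivial_on_torus hκ)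
      (M.mul_eq_mul_of_trivial_on_torus hκ') fun h0 => hF ξ hξ ?_
    rw [show ξ = 0 from Prod.ext (Subtype.ext h0.1) (Subtype.ext h0.2), map_zero]
  · rintro κ ⟨y, hy⟩
    by_contra hcon
    simp only [Set.mem_iUnion, not_exists] at hcon
    obtain ⟨t, ht, hyt⟩ := hF' (M.torus κ) (M.isClosed_torus κ) (fun ξ hξ => by
      have := hcon ξ hξ
      simpa using this) y
    exact hy t ht hyt

/-! ### The action on the quotient of X² by T^κ -/

theorem diagAct_proj (n : Multiplicative (Fin r → ℤ)) (v : mixedSpace K × mixedSpace K) :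
    M.diagAct n (M.proj v) =
      M.proj (mixedEmbedding K (M.ζ n : K) * v.1, mixedEmbedding K (M.ζ n : K) * v.2) := rfl

theorem diagAct_one (x : M.X × M.X) : M.diagAct 1 x = x := by
  obtain ⟨v, rfl⟩ := M.proj_surjective x
  rw [diagAct_proj]
  simp

theorem diagAct_mul (n m : Multiplicative (Fin r → ℤ)) (x : M.X × M.X) :
    M.diagAct (n * m) x = M.diagAct n (M.diagAct m x) := by
  obtain ⟨v, rfl⟩ := M.proj_surjective x
  simp only [diagAct_proj, map_mul, Units.coe_mul, mul_assoc]

theorem mul_mem_slopeFreq (κ : OnePoint K) (n : Multiplicative (Fin r → ℤ)) {ξ : mixedSpace K}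
    (hξ : ξ ∈ M.slopeFreq κ) : mixedEmbedding K (M.ζ n : K) * ξ ∈ M.slopeFreq κ := by
  have key : ∀ a, a * ξ ∈ annihilator M.Γ →
      a * (mixedEmbedding K (M.ζ n : K) * ξ) ∈ annihilator M.Γ := fun a ha γ hγ => by
    rw [mul_left_comm, pairing_comm, pairing_mul_left, pairing_comm]
    exact ha _ (M.Γ_stable n γ hγ)
  exact ⟨key _ hξ.1, key _ hξ.2⟩

theorem mul_mem_annihilator_slopeFreq (κ : OnePoint K) (n : Multiplicative (Fin r → ℤ))
    (x : mixedSpace K) (hx : x ∈ annihilator (M.slopeFreq κ)) :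
    mixedEmbedding K (M.ζ n : K) * x ∈ annihilator (M.slopeFreq κ) := fun ξ hξ => by
  rw [← pairing_mul_left]
  exact hx _ (M.mul_mem_slopeFreq κ n hξ)

theorem le_annihilator_slopeFreq (κ : OnePoint K) : M.Γ ≤ annihilator (M.slopeFreq κ) :=
  fun _ hγ ξ hξ => M.le_annihilator_annihilator hγ ξ (M.slopeFreq_le κ hξ)

/-- The quotient of `X²` by `T^κ`. -/
abbrev slopeQuotient (κ : OnePoint K) : Type _ := mixedSpace K ⧸ annihilator (M.slopeFreq κ)

/-- The quotient map of `X²` by `T^κ`. -/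
noncomputable def slopeMap (κ : OnePoint K) : M.X × M.X →+ M.slopeQuotient κ :=
  (QuotientAddGroup.map M.Γ (annihilator (M.slopeFreq κ))
    (AddMonoidHom.mulLeft (mixedEmbedding K (slopeCoeff κ).1)) fun γ hγ ξ hξ => by
      rw [AddMonoidHom.coe_mulLeft, ← pairing_mul_left, pairing_comm]
      exact hξ.1 γ hγ).coprod
  (QuotientAddGroup.map M.Γ (annihilator (M.slopeFreq κ))
    (AddMonoidHom.mulLeft (mixedEmbedding K (slopeCoeff κ).2)) fun γ hγ ξ hξ => by
      rw [AddMonoidHom.coe_mulLeft, ← pairing_mul_left, pairing_comm]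
      exact hξ.2 γ hγ)

theorem slopeMap_proj (κ : OnePoint K) (v : mixedSpace K × mixedSpace K) :
    M.slopeMap κ (M.proj v) = ((mixedEmbedding K (slopeCoeff κ).1 * v.1 +
      mixedEmbedding K (slopeCoeff κ).2 * v.2 : mixedSpace K) : M.slopeQuotient κ) := rfl

theorem slopeMap_eq_zero_iff (κ : OnePoint K) (x : M.X × M.X) :
    M.slopeMap κ x = 0 ↔ x ∈ M.torus κ := by
  obtain ⟨v, rfl⟩ := M.proj_surjective x
  rw [proj_mem_torus_iff, slopeMap_proj]
  exact QuotientAddGroup.eq_zero_iff _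

/-- The action of `ℤ^r` on the quotient of `X²` by `T^κ`. -/
noncomputable instance (κ : OnePoint K) :
    DistribMulAction (Multiplicative (Fin r → ℤ)) (M.slopeQuotient κ) :=
  quotientAction M.ζ _ (M.mul_mem_annihilator_slopeFreq κ)

theorem slopeMap_diagAct (κ : OnePoint K) (n : Multiplicative (Fin r → ℤ)) (x : M.X × M.X) :
    M.slopeMap κ (M.diagAct n x) = n • M.slopeMap κ x := by
  obtain ⟨v, rfl⟩ := M.proj_surjective x
  rw [diagAct_proj, slopeMap_proj, slopeMap_proj]
  change _ = ((mixedEmbedding K (M.ζ n : K) * (mixedEmbedding K (slopeCoeff κ).1 * v.1 +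
      mixedEmbedding K (slopeCoeff κ).2 * v.2) : mixedSpace K) : M.slopeQuotient κ)
  congr 1
  ring

/-- `slopeMap` is equivariant with kernel T^κ. -/
theorem homogeneous_eq_preimage_orbit (κ : OnePoint K) (z : M.X × M.X) :
    {x | ∃ n : Multiplicative (Fin r → ℤ), ∃ t ∈ M.torus κ, x = M.diagAct n (z + t)} =
      M.slopeMap κ ⁻¹' MulAction.orbit (Multiplicative (Fin r → ℤ)) (M.slopeMap κ z) := by
  ext x
  constructor
  · rintro ⟨n, t, ht, rfl⟩
    refine ⟨n, ?_⟩
    rw [slopeMap_diagAct, map_add, (M.slopeMap_eq_zero_iff κ t).2 ht, add_zero]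
  · rintro ⟨n, hn⟩
    refine ⟨n, M.diagAct n⁻¹ x - z, ?_, ?_⟩
    · rw [← slopeMap_eq_zero_iff, map_sub, slopeMap_diagAct, ← hn]
      simp
    · rw [add_sub_cancel, ← diagAct_mul, mul_inv_cancel, diagAct_one]

/-- The section x ↦ (sx, tx) is continuous, so small vectors of the quotient lift to small vectors
of X². -/
theorem image_slopeMap_mem_nhds (κ : OnePoint K) {ε : ℝ} (hε : 0 < ε) :
    M.slopeMap κ '' {x | M.norm x < ε} ∈ 𝓝 0 := by
  obtain ⟨s, t, hst⟩ := exists_slopeCoeff_combination κ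
  let j : mixedSpace K → mixedSpace K × mixedSpace K :=
    fun x => (mixedEmbedding K s * x, mixedEmbedding K t * x)
  have hj : Continuous j := by fun_prop
  have hj0 : j 0 = 0 := by simp [j]
  have hnhds : j ⁻¹' {v | euclNorm v < ε} ∈ 𝓝 0 :=
    hj.continuousAt.preimage_mem_nhds (by
      rw [hj0]
      exact euclNorm_lt_mem_nhds hε)
  have himg : (fun x : mixedSpace K => (x : M.slopeQuotient κ)) '' (j ⁻¹' {v | euclNorm v < ε}) ∈
      𝓝 ((0 : mixedSpace K) : M.slopeQuotient κ) :=
    (QuotientAddGroup.isOpenMap_coe (N := annihilator (M.slopeFreq κ))).image_mem_nhds hnhds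
  refine mem_of_superset himg ?_
  rintro _ ⟨x, hx, rfl⟩
  refine ⟨M.proj (j x), (M.norm_proj_le _).trans_lt hx, ?_⟩
  rw [slopeMap_proj]
  simp only [j]
  rw [← mul_assoc, ← mul_assoc, ← add_mul, ← map_mul, ← map_mul, ← map_add, hst, map_one, one_mul]

/-- For a given slope, only finitely many homogeneous invariant sets are not `ε`-dense. -/
theorem finite_homogeneous_of_slope (hr : 2 ≤ r) (κ : OnePoint K) {ε : ℝ} (hε : 0 < ε) :
    {L : Set (M.X × M.X) | ¬ M.IsEpsDense ε L ∧ ∃ z, L = {x | ∃ n : Multiplicative (Fin r → ℤ),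
      ∃ t ∈ M.torus κ, x = M.diagAct n (z + t)}}.Finite := by
  have : CompactSpace M.X := M.Γ_cocompact
  have : CompactSpace (M.slopeQuotient κ) := by
    have hc : Continuous (QuotientAddGroup.map M.Γ (annihilator (M.slopeFreq κ))
        (AddMonoidHom.id _) (M.le_annihilator_slopeFreq κ)) :=
      continuous_quot_lift _ continuous_quotient_mk'
    have hs : Function.Surjective (QuotientAddGroup.map M.Γ (annihilator (M.slopeFreq κ))
        (AddMonoidHom.id _) (M.le_annihilator_slopeFreq κ)) := fun y => by
      obtain ⟨x, rfl⟩ := QuotientAddGroup.mk_surjective y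
      exact ⟨x, rfl⟩
    exact ⟨hs.range_eq ▸ isCompact_range hc⟩
  have : IsClosed (annihilator (M.slopeFreq κ) : Set (mixedSpace K)) := isClosed_annihilator _
  have : ContinuousConstSMul (Multiplicative (Fin r → ℤ)) (M.slopeQuotient κ) :=
    ⟨fun n => continuous_quotientMap _ (M.mul_mem_annihilator_slopeFreq κ n)⟩
  obtain ⟨N, hN, hNΓ⟩ := M.exists_nat_mul_mem
  let Q := annihilatorPresentation (M.slopeFreq κ) fun ξ hξ =>
    M.exists_mixedEmbedding_eq_of_mem_dual (M.slopeFreq_le κ hξ)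
  have hcard : 3 ≤ Fintype.card (InfinitePlace K) := by
    rw [InfinitePlace.card_eq_nrRealPlaces_add_nrComplexPlaces, M.places]
    omega
  have hfin := Q.finite_orbits_missing_translate (H := Multiplicative (Fin r → ℤ)) (φ := M.ζ)
    (fun _ _ => rfl) M.ζ_finiteIndex hcard M.not_isCM hN
    (fun x => (QuotientAddGroup.eq_zero_iff _).2 (M.le_annihilator_slopeFreq κ (hNΓ x)))
    (M.image_slopeMap_mem_nhds κ hε)
  refine (hfin.image fun O => M.slopeMap κ ⁻¹' O).subset ?_
  rintro L ⟨hL, z, hLz⟩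
  rw [homogeneous_eq_preimage_orbit] at hLz
  refine ⟨_, ⟨_, rfl, ?_⟩, hLz.symm⟩
  simp only [IsEpsDense, not_forall, not_exists, not_and] at hL
  obtain ⟨y, hy⟩ := hL
  -- L is a full preimage, so if it misses the ball about y, its orbit misses the image of that
  -- ball.
  refine ⟨M.slopeMap κ y, ?_⟩
  rintro _ ⟨x, hx, rfl⟩ hmem
  rw [← map_add] at hmem
  refine hy (y + x) (hLz ▸ hmem) ?_
  rwa [add_sub_cancel_left]

end Model

end DiagonalUnitAction

theorem mainTheorem4 {K : Type*} [Field K] [NumberField K] {r : ℕ} (hr : 2 ≤ r)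
    (M : DiagonalUnitAction.Model K r) (ε : ℝ) (hε : 0 < ε) :
    {L : Set (M.X × M.X) | M.IsHomogeneous L ∧ ¬ M.IsEpsDense ε L}.Finite := by
  refine ((M.finite_slopes hε).biUnion fun κ _ =>
    M.finite_homogeneous_of_slope hr κ hε).subset ?_
  rintro L ⟨⟨z, -, κ, hL⟩, hdense⟩
  refine Set.mem_biUnion (x := κ) ?_ ⟨hdense, z, hL⟩
  simp only [DiagonalUnitAction.Model.IsEpsDense, not_forall, not_exists, not_and] at hdense
  obtain ⟨y, hy⟩ := hdense
  -- L contains z + T^κ, so a ball about y that misses L puts κ in the finite set of exceptional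
  -- slopes.
  refine ⟨z - y, fun t ht => ?_⟩
  have := hy (z + t) (by
    rw [hL]
    exact ⟨1, t, ht, (M.diagAct_one _).symm⟩)
  rwa [add_sub_right_comm] at this
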